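/- Let $n,r\ge 0$ be integers. Let $\Lambda(n,r)$ be the set of $\lambda\in\mathbb Z_{\ge0}^n$ with $\sum_i\lambda_i=r$, and let $M_n(r)$ be the set of $n\times n$ matrices of nonnegative integers with entry sum $r$; $\mathrm{ro}(A)$ and $\mathrm{co}(A)$ are the vectors of row and column sums of $A$. **Schur algebra.** Let $H_r(q)$ be the Hecke algebra of $\mathfrak S_r$ over $\mathbb Z[q]$, with generators $T_1,\dots,T_{r-1}$, braid relations and $T_i^2=(q-1)T_i+q$; let $T_w=T_{i_1}\cdots T_{i_t}$ for a reduced expression $w=s_{i_1}\cdots s_{i_t}$, and $x_\lambda=\sum_{w\in\mathfrak S_\lambda}T_w$, where $\mathfrak S_\lambda$ is the Young subgroup of $\lambda$. Put $S_q(n,r)=\operatorname{End}_{H_r(q)}\bigl(\bigoplus_{\lambda\in\Lambda(n,r)}x_\lambda H_r(q)\bigr)$ (right modules) and $\mathbf S_0(n,r)=\mathbb C\otimes_{\mathbb Z[q]}S_q(n,r)$, where $q$ acts on $\mathbb C$ by $0$. For $A\in M_n(r)$ with $\lambda=\mathrm{ro}(A)$, $\mu=\mathrm{co}(A)$, let $D_A$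 be the $(\mathfrak S_\lambda,\mathfrak S_\mu)$-double coset of all $w\in\mathfrak S_r$ with $a_{ij}=|R_i^\lambda\cap wR_j^\mu|$, where $R_i^\lambda=\{\lambda_1+\dots+\lambda_{i-1}+1,\dots,\lambda_1+\dots+\lambda_i\}$. There is a unique element of $S_q(n,r)$ with $x_\nu h\mapsto\delta_{\mu\nu}\bigl(\sum_{w\in D_A}T_w\bigr)h\in x_\lambda H_r(q)$; let $e_A\in\mathbf S_0(n,r)$ be its image. Let $D_\lambda=\operatorname{diag}(\lambda_1,\dots,\lambda_n)$ and let $E_{ab}$ be the matrix units. Put $k_\lambda=e_{D_\lambda}$ and, for $1\le i\le n-1$, $$e_i=\sum_{\lambda\in\Lambda(n,r)}e_{D_\lambda-E_{i+1,i+1}+E_{i,i+1}},\qquad f_i=\sum_{\lambda\in\Lambda(n,r)}e_{D_\lambda-E_{i,i}+E_{i+1,i}},$$ where a term whose matrix has a negative entry is $0$. **Tensor space.** Let $\mathbf H_r(0)$ be the $0$-Hecke algebra over $\mathbb C$ with generators $\bar\pi_i$ (braid relations and $\bar\pi_i^2=-\bar\pi_i$), and let $\bar x_\lambda=\sum_{w\in\mathfrak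 S_\lambda}\bar\pi_w$. Let $V_0=\mathbb C^n$ with standard basis $\bar\xi_1,\dots,\bar\xi_n$. The algebra $\mathbf H_r(0)$ acts from the right on $V_0^{\otimes r}$: for $\mathbf v=\bar\xi_{k_1}\otimes\cdots\otimes\bar\xi_{k_r}$, the vector $\mathbf v\bar\pi_i$ is $\mathbf v$ with its $i$-th and $(i+1)$-st factors interchanged if $k_i<k_{i+1}$, it is $0$ if $k_i=k_{i+1}$, and it is $-\mathbf v$ if $k_i>k_{i+1}$. Specialization at $q=0$ induces a $\mathbb C$-algebra isomorphism $\mathbf S_0(n,r)\cong\operatorname{End}_{\mathbf H_r(0)}\bigl(\bigoplus_\lambda\bar x_\lambda\mathbf H_r(0)\bigr)$, and there is an isomorphism of right $\mathbf H_r(0)$-modules $\bigoplus_\lambda\bar x_\lambda\mathbf H_r(0)\cong V_0^{\otimes r}$ with $\bar x_\lambda\mapsto\bar\xi_1^{\otimes\lambda_1}\otimes\cdots\otimes\bar\xi_n^{\otimes\lambda_n}$. Together they identify $\mathbf S_0(n,r)$ with $\operatorname{End}_{\mathbf H_r(0)}(V_0^{\otimes r})$. **Degenerate quantum group.** Let $U_0(\mathfrak{gl}_n)$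 be the unital $\mathbb C$-algebra generated by $\mathbf e_i,\mathbf f_i$ $(1\le i\le n-1)$ and $\mathbf k_i$ $(1\le i\le n)$ with the relations $\mathbf k_i\mathbf k_j=\mathbf k_j\mathbf k_i$; $\mathbf e_i\mathbf k_{i+1}=\mathbf k_i\mathbf e_i=\mathbf k_{i+1}\mathbf f_i=\mathbf f_i\mathbf k_i=0$; $\mathbf k_i\mathbf e_j=\mathbf e_j\mathbf k_i$ and $\mathbf k_i\mathbf f_j=\mathbf f_j\mathbf k_i$ for $j\ne i-1,i$; $[\mathbf e_i,\mathbf f_j]=\delta_{ij}(\mathbf k_{i+1}-\mathbf k_i)$; $[\mathbf e_i,\mathbf e_j]=[\mathbf f_i,\mathbf f_j]=0$ for $|i-j|>1$; and, for $1\le i\le n-2$, $\mathbf e_i^2\mathbf e_{i+1}=\mathbf e_i\mathbf e_{i+1}\mathbf e_i$, $\mathbf e_i\mathbf e_{i+1}^2=\mathbf e_{i+1}\mathbf e_i\mathbf e_{i+1}$, $\mathbf f_{i+1}\mathbf f_i^2=\mathbf f_i\mathbf f_{i+1}\mathbf f_i$, $\mathbf f_{i+1}^2\mathbf f_i=\mathbf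 f_{i+1}\mathbf f_i\mathbf f_{i+1}$, $\mathbf e_i\mathbf e_{i+1}\mathbf k_{i+1}=\mathbf k_{i+1}\mathbf e_i\mathbf e_{i+1}$, $\mathbf f_{i+1}\mathbf f_i\mathbf k_{i+1}=\mathbf k_{i+1}\mathbf f_{i+1}\mathbf f_i$. It is a bialgebra with $\Delta(\mathbf e_i)=1\otimes\mathbf e_i+\mathbf e_i\otimes\mathbf k_i$, $\Delta(\mathbf f_i)=\mathbf k_{i+1}\otimes\mathbf f_i+\mathbf f_i\otimes1$, $\Delta(\mathbf k_i)=\mathbf k_i\otimes\mathbf k_i$, $\epsilon(\mathbf e_i)=\epsilon(\mathbf f_i)=0$, $\epsilon(\mathbf k_i)=1$. It acts on $V_0$ by $\mathbf e_i\mapsto E_{i,i+1}$, $\mathbf f_i\mapsto E_{i+1,i}$, $\mathbf k_i\mapsto\sum_{j\ne i}E_{jj}$, and on $V_0^{\otimes r}$ through the comultiplication (through $\epsilon$ if $r=0$). **Statement.** The action of $U_0(\mathfrak{gl}_n)$ on $V_0^{\otimes r}$ commutes with that of $\mathbf H_r(0)$, and the induced algebra homomorphism $\psi_{n,r}:U_0(\mathfrak{gl}_n)\to\operatorname{End}_{\mathbf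 H_r(0)}(V_0^{\otimes r})\cong\mathbf S_0(n,r)$ satisfies $$\psi_{n,r}(\mathbf e_i)=e_i,\quad \psi_{n,r}(\mathbf f_i)=f_i\quad(1\le i\le n-1),\qquad \psi_{n,r}(\mathbf k_i)=\sum_{\mu\in\Lambda(n,r),\ \mu_i=0}k_\mu\quad(1\le i\le n).$$ -/

import Mathlib

open scoped TensorProduct DirectSum

noncomputable section

namespace ZeroSchur

/-! ### Indices, weak compositions, matrices, Young subgroups -/

/-- The pairs `(i, i+1)` of adjacent elements of `Fin m` (there are `m - 1` of them). -/
abbrev Adj (m : ℕ) : Type := {i : ℕ // i + 1 < m}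

/-- The left element of an adjacent pair. -/
def Adj.lo {m : ℕ} (i : Adj m) : Fin m := ⟨i.1, Nat.lt_of_succ_lt i.2⟩

/-- The right element of an adjacent pair. -/
def Adj.hi {m : ℕ} (i : Adj m) : Fin m := ⟨i.1 + 1, i.2⟩

/-- `Λ(n, r)`: the weak compositions of `r` with `n` parts. -/
abbrev WComp (n r : ℕ) : Type := {l : Fin n → ℕ // ∑ i, l i = r}

instance (n r : ℕ) : Fintype (WComp n r) :=
  Fintype.subtype (Finset.piAntidiag Finset.univ r) (by simp)

/-- `M_n(r)`: the `n × n` matrices of nonnegative integers with entry sum `r`. -/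
abbrev NMat (n r : ℕ) : Type := {A : Matrix (Fin n) (Fin n) ℕ // ∑ i, ∑ j, A i j = r}

/-- The vector of row sums. -/
def ro {n r : ℕ} (A : NMat n r) : WComp n r := ⟨fun i => ∑ j, A.1 i j, A.2⟩

/-- The vector of column sums. -/
def co {n r : ℕ} (A : NMat n r) : WComp n r :=
  ⟨fun j => ∑ i, A.1 i j, by rw [Finset.sum_comm]; exact A.2⟩

/-- The weakly increasing word `1 ⋯ 1 2 ⋯ 2 ⋯ n ⋯ n` in which the letter `i` occurs `l i` times. -/
def iword {n r : ℕ} (l : WComp n r) (p : Fin r) : Fin n :=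
  (finSigmaFinEquiv.symm (Fin.cast l.2.symm p)).1

/-- The `i`-th block `R_i` of consecutive positions (of size `l i`) of a weak composition. -/
def block {n r : ℕ} (l : WComp n r) (i : Fin n) : Finset (Fin r) :=
  Finset.univ.filter fun p => iword l p = i

/-- The Young subgroup: the permutations that preserve each block. -/
def young {n r : ℕ} (l : WComp n r) : Subgroup (Equiv.Perm (Fin r)) where
  carrier := {w | ∀ p, iword l (w p) = iword l p}
  mul_mem' := by
    intro a b ha hb p
    rw [Equiv.Perm.mul_apply, ha, hb]
  one_mem' := by intro p; rfl
  inv_mem' := by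
    intro a ha p
    have h := ha (a⁻¹ p)
    simpa using h.symm

/-- The matrix with entries `|R_i^l ∩ w R_j^m|`. -/
def relPos {n r : ℕ} (l m : WComp n r) (w : Equiv.Perm (Fin r)) : Matrix (Fin n) (Fin n) ℕ :=
  fun i j => (block l i ∩ (block m j).map w.toEmbedding).card

/-- The double coset of `young (ro A)` and `young (co A)` that corresponds to `A`: the permutations
`w` with `A i j = |R_i ∩ w R_j|`, where `R_i`, `R_j` are the blocks of `ro A` and `co A`
(see `coset_eq_doubleCoset`). -/
def coset {n r : ℕ} (A : NMat n r) : Set (Equiv.Perm (Fin r)) :=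
  {w | relPos (ro A) (co A) w = A.1}

theorem mem_coset_iff {n r : ℕ} (A : NMat n r) (w : Equiv.Perm (Fin r)) :
    w ∈ coset A ↔ ∀ i j, (Finset.univ.filter fun p =>
      iword (ro A) p = i ∧ iword (co A) (w⁻¹ p) = j).card = A.1 i j := by
  have h : ∀ i j, block (ro A) i ∩ (block (co A) j).map w.toEmbedding =
      Finset.univ.filter fun p => iword (ro A) p = i ∧ iword (co A) (w⁻¹ p) = j := by
    intro i j
    ext p
    simp only [block, Finset.mem_inter, Finset.mem_filter, Finset.mem_univ, true_and,
      Finset.mem_map_equiv]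
    rfl
  simp only [coset, Set.mem_ofPred_eq, ← Matrix.ext_iff, relPos, h]

theorem coset_eq_doubleCoset {n r : ℕ} (A : NMat n r) (w : Equiv.Perm (Fin r)) (hw : w ∈ coset A) :
    coset A = DoubleCoset.doubleCoset w (young (ro A)) (young (co A)) := by
  ext w'
  rw [DoubleCoset.mem_doubleCoset]
  constructor
  · intro hw'
    rw [mem_coset_iff] at hw hw'
    have hcard : ∀ c : Fin n × Fin n,
        Nonempty ({p // (iword (ro A) p, iword (co A) (w⁻¹ p)) = c} ≃
          {p // (iword (ro A) p, iword (co A) (w'⁻¹ p)) = c}) := by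
      rintro ⟨i, j⟩
      rw [← Fintype.card_eq, Fintype.card_subtype, Fintype.card_subtype]
      simpa only [Prod.mk.injEq] using (hw i j).trans (hw' i j).symm
    let E := fun c => (hcard c).some
    let u : Equiv.Perm (Fin r) :=
      (Equiv.sigmaFiberEquiv fun p => (iword (ro A) p, iword (co A) (w⁻¹ p))).symm.trans
        ((Equiv.sigmaCongrRight E).trans
          (Equiv.sigmaFiberEquiv fun p => (iword (ro A) p, iword (co A) (w'⁻¹ p))))
    have hu : ∀ p, (iword (ro A) (u p), iword (co A) (w'⁻¹ (u p))) =
        (iword (ro A) p, iword (co A) (w⁻¹ p)) := fun p =>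
      (E (iword (ro A) p, iword (co A) (w⁻¹ p)) ⟨p, rfl⟩).2
    refine ⟨u, fun p => congrArg Prod.fst (hu p), w⁻¹ * u⁻¹ * w', ?_, by group⟩
    refine (Subgroup.inv_mem_iff _).1 fun p => ?_
    have := congrArg Prod.snd (hu (w p))
    simpa using this
  · rintro ⟨u, hu, v, hv, rfl⟩
    rw [mem_coset_iff] at hw ⊢
    intro i j
    rw [← hw i j]
    refine Finset.card_equiv u⁻¹ fun p => ?_
    have h1 : iword (ro A) (u⁻¹ p) = iword (ro A) p := (young (ro A)).inv_mem hu p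
    have h2 : ∀ x, iword (co A) (v⁻¹ x) = iword (co A) x := (young (co A)).inv_mem hv
    simp only [Finset.mem_filter, Finset.mem_univ, true_and, mul_inv_rev, Equiv.Perm.mul_apply, h1,
      h2]

/-- The simple transposition `s_i = (i, i+1)`. -/
def simpleSwap {r : ℕ} (i : Adj r) : Equiv.Perm (Fin r) := Equiv.swap i.lo i.hi

/-- The words in the simple transpositions of minimal length among those with product `w`. -/
def IsReducedWord {r : ℕ} (w : Equiv.Perm (Fin r)) (L : List (Adj r)) : Prop :=
  (L.map simpleSwap).prod = w ∧
    ∀ L' : List (Adj r), (L'.map simpleSwap).prod = w → L.length ≤ L'.length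

theorem exists_word {r : ℕ} (w : Equiv.Perm (Fin r)) :
    ∃ L : List (Adj r), (L.map simpleSwap).prod = w := by
  rcases r with _ | r
  · exact ⟨[], Subsingleton.elim _ _⟩
  · have hw : w ∈ Submonoid.closure
        (Set.range fun i : Fin r => Equiv.swap i.castSucc i.succ) := by
      rw [Equiv.Perm.mclosure_swap_castSucc_succ]; trivial
    induction hw using Submonoid.closure_induction with
    | mem x hx =>
      obtain ⟨i, rfl⟩ := hx
      refine ⟨[⟨i.1, by omega⟩], ?_⟩
      simp only [List.map_cons, List.map_nil, List.prod_cons, List.prod_nil, mul_one]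
      rfl
    | one => exact ⟨[], rfl⟩
    | mul x y _ _ hx hy =>
      obtain ⟨L, rfl⟩ := hx
      obtain ⟨L', rfl⟩ := hy
      exact ⟨L ++ L', by simp⟩

theorem exists_reducedWord {r : ℕ} (w : Equiv.Perm (Fin r)) :
    ∃ L : List (Adj r), IsReducedWord w L := by
  classical
  have h : ∃ k : ℕ, ∃ L : List (Adj r), (L.map simpleSwap).prod = w ∧ L.length = k := by
    obtain ⟨L, hL⟩ := exists_word w
    exact ⟨_, L, hL, rfl⟩
  obtain ⟨L, hL, hk⟩ := Nat.find_spec h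
  exact ⟨L, hL, fun L' hL' => hk ▸ Nat.find_min' h ⟨L', hL', rfl⟩⟩

/-- A chosen reduced expression of `w`. -/
def reducedWord {r : ℕ} (w : Equiv.Perm (Fin r)) : List (Adj r) := (exists_reducedWord w).choose

/-! ### Hecke algebras of type A -/

section Hecke

variable (R : Type) [CommRing R] (q : R)

/-- The defining relations of the Hecke algebra. -/
inductive HeckeRel (r : ℕ) : FreeAlgebra R (Adj r) → FreeAlgebra R (Adj r) → Prop
  | quad (i : Adj r) : HeckeRel r (FreeAlgebra.ι R i * FreeAlgebra.ι R i)
      ((q - 1) • FreeAlgebra.ι R i + algebraMap R _ q)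
  | comm (i j : Adj r) (h : i.1 + 1 < j.1 ∨ j.1 + 1 < i.1) :
      HeckeRel r (FreeAlgebra.ι R i * FreeAlgebra.ι R j) (FreeAlgebra.ι R j * FreeAlgebra.ι R i)
  | braid (i j : Adj r) (h : j.1 = i.1 + 1) :
      HeckeRel r (FreeAlgebra.ι R i * FreeAlgebra.ι R j * FreeAlgebra.ι R i)
        (FreeAlgebra.ι R j * FreeAlgebra.ι R i * FreeAlgebra.ι R j)

/-- The Hecke algebra of the symmetric group on `r` letters over `R` with parameter `q`.
`Hecke ℤ[X] X r` is the generic Hecke algebra, and `Hecke ℂ 0 r` is the `0`-Hecke algebra. -/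
def Hecke (r : ℕ) : Type := RingQuot (HeckeRel R q r)

instance (r : ℕ) : Ring (Hecke R q r) := inferInstanceAs (Ring (RingQuot (HeckeRel R q r)))

instance (r : ℕ) : Algebra R (Hecke R q r) :=
  inferInstanceAs (Algebra R (RingQuot (HeckeRel R q r)))

variable {n r : ℕ}

/-- The generators `T_i` (written `π̄_i` for `q = 0`). -/
def Hecke.T (i : Adj r) : Hecke R q r :=
  RingQuot.mkAlgHom R (HeckeRel R q r) (FreeAlgebra.ι R i)

/-- `T_w = T_{i_1} ⋯ T_{i_t}` for a reduced expression `w = s_{i_1} ⋯ s_{i_t}`. -/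
def Hecke.Tw (w : Equiv.Perm (Fin r)) : Hecke R q r := ((reducedWord w).map (Hecke.T R q)).prod

open Classical in
/-- `x_l`, the sum of the `T_w` over the Young subgroup of `l`. -/
def xsum (l : WComp n r) : Hecke R q r :=
  ∑ w ∈ Finset.univ.filter (fun w => w ∈ young l), Hecke.Tw R q w

open Classical in
/-- The sum of the `T_w` over the double coset that corresponds to `A`. -/
def cosetSum (A : NMat n r) : Hecke R q r :=
  ∑ w ∈ Finset.univ.filter (fun w => w ∈ coset A), Hecke.Tw R q w

/-- The right ideal `x_l H`. -/
abbrev xH (l : WComp n r) : Submodule (Hecke R q r)ᵐᵒᵖ (Hecke R q r) :=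
  Submodule.span _ {xsum R q l}

variable (n r)

/-- The right `H`-module `⨁ x_l H`, the sum over all `l ∈ Λ(n, r)`. -/
abbrev PermMod : Type := ⨁ l : WComp n r, xH R q l

/-- The endomorphism algebra of the right `H`-module `⨁ x_l H`; for `R = ℤ[X]` and `q = X` this is
the `q`-Schur algebra. -/
abbrev Schur : Type := Module.End (Hecke R q r)ᵐᵒᵖ (PermMod R q n r)

variable {n r}

/-- The element `x_l` of the summand `x_l H`. -/
def gen (l : WComp n r) : PermMod R q n r :=
  DirectSum.of (fun l : WComp n r => xH R q l) l
    ⟨xsum R q l, Submodule.subset_span (Set.mem_singleton _)⟩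

/-- `φ` is the endomorphism `x_ν h ↦ δ_{ν, co A} X h` with values in the summand indexed by `ro A`,
where `X` is the sum of the `T_w` over the double coset that corresponds to `A`. -/
def IsStd (A : NMat n r) (φ : Schur R q n r) : Prop :=
  ∀ ν κ : WComp n r, ((φ (gen R q ν) κ : xH R q κ) : Hecke R q r) =
    if ν = co A ∧ κ = ro A then cosetSum R q A else 0

open Classical in
/-- The standard basis element of the Schur algebra that corresponds to `A`. (It exists, and it is
unique because the elements `gen ν` generate the module.) -/
def std (A : NMat n r) : Schur R q n r :=
  if h : ∃ φ, IsStd R q A φ then h.choose else 0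

/-! ### The right action of the Hecke algebra on tensor space -/

variable (n r) in
/-- The tensor space `(R^n)^{⊗ r}`. -/
abbrev TSpace : Type := TensorPower R r (Fin n → R)

/-- The basis `ξ_{k_1} ⊗ ⋯ ⊗ ξ_{k_r}` of the tensor space, indexed by words. -/
def ξ : Module.Basis (Fin r → Fin n) R (TSpace R n r) :=
  Basis.piTensorProduct fun _ => Pi.basisFun R (Fin n)

/-- The right action of the generator `T_i` on the tensor space. -/
def actT (i : Adj r) : Module.End R (TSpace R n r) :=
  (ξ R).constr R fun k =>
    if k i.lo < k i.hi then ξ R (k ∘ simpleSwap i)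
    else if k i.lo = k i.hi then q • ξ R k
    else q • ξ R (k ∘ simpleSwap i) + (q - 1) • ξ R k

theorem actT_ξ (i : Adj r) (k : Fin r → Fin n) : actT R q i (ξ R k) =
    if k i.lo < k i.hi then ξ R (k ∘ simpleSwap i)
    else if k i.lo = k i.hi then q • ξ R k
    else q • ξ R (k ∘ simpleSwap i) + (q - 1) • ξ R k := by
  simp only [actT, Module.Basis.constr_basis]

theorem actT_quad (i : Adj r) : actT R q (n := n) i * actT R q i =
    (q - 1) • actT R q i + algebraMap R _ q := by
  refine (ξ R).ext fun k => ?_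
  have h1 : (k ∘ simpleSwap i) i.lo = k i.hi := by simp [simpleSwap]
  have h2 : (k ∘ simpleSwap i) i.hi = k i.lo := by simp [simpleSwap]
  have h3 : (k ∘ simpleSwap i) ∘ simpleSwap i = k := by
    funext p; simp [simpleSwap]
  simp only [Module.End.mul_apply, LinearMap.add_apply, LinearMap.smul_apply, Module.algebraMap_end_apply,
    actT_ξ]
  rcases lt_trichotomy (k i.lo) (k i.hi) with h | h | h
  · rw [if_pos h, actT_ξ, h1, h2, h3, if_neg (not_lt.2 h.le), if_neg h.ne']
    module
  · rw [if_neg h.not_lt, if_pos h, map_smul, actT_ξ, if_neg h.not_lt, if_pos h]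
    module
  · rw [if_neg (not_lt.2 h.le), if_neg h.ne', map_add, map_smul, map_smul, actT_ξ, actT_ξ, h1, h2, h3,
      if_pos h, if_neg (not_lt.2 h.le), if_neg h.ne']
    module

theorem actT_comm (i j : Adj r) (h : i.1 + 1 < j.1 ∨ j.1 + 1 < i.1) :
    actT R q (n := n) i * actT R q j = actT R q j * actT R q i := by
  refine (ξ R).ext fun k => ?_
  have hne : i.lo ≠ j.lo ∧ i.lo ≠ j.hi ∧ i.hi ≠ j.lo ∧ i.hi ≠ j.hi := by
    simp only [Adj.lo, Adj.hi, ne_eq, Fin.mk.injEq]; omega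
  obtain ⟨a, b, c, d⟩ := hne
  have h1 : (k ∘ simpleSwap i) j.lo = k j.lo := by
    simp [simpleSwap, Equiv.swap_apply_of_ne_of_ne a.symm c.symm]
  have h2 : (k ∘ simpleSwap i) j.hi = k j.hi := by
    simp [simpleSwap, Equiv.swap_apply_of_ne_of_ne b.symm d.symm]
  have h3 : (k ∘ simpleSwap j) i.lo = k i.lo := by
    simp [simpleSwap, Equiv.swap_apply_of_ne_of_ne a b]
  have h4 : (k ∘ simpleSwap j) i.hi = k i.hi := by
    simp [simpleSwap, Equiv.swap_apply_of_ne_of_ne c d]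
  have h5 : (k ∘ simpleSwap i) ∘ simpleSwap j = (k ∘ simpleSwap j) ∘ simpleSwap i := by
    have : simpleSwap i * simpleSwap j = simpleSwap j * simpleSwap i :=
      (Equiv.Perm.disjoint_swap_swap (by simp [Adj.lo, Adj.hi]; omega)).commute
    funext p
    exact congrArg k (DFunLike.congr_fun this p)
  simp only [Module.End.mul_apply, actT_ξ]
  split_ifs <;> simp only [map_add, map_smul, actT_ξ, lt_self_iff_false, *, if_true, if_false] <;> module

theorem actT_braid (i j : Adj r) (h : j.1 = i.1 + 1) :
    actT R q (n := n) i * actT R q j * actT R q i = actT R q j * actT R q i * actT R q j := by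
  have hm : j.lo = i.hi := by simp [Adj.lo, Adj.hi, h]
  have hab : i.lo ≠ i.hi := by simp [Adj.lo, Adj.hi]
  have hbc : i.hi ≠ j.hi := by simp [Adj.hi, h]
  have hac : i.lo ≠ j.hi := by
    simp only [Adj.lo, Adj.hi, ne_eq, Fin.mk.injEq]
    omega
  have key : simpleSwap i * simpleSwap j * simpleSwap i =
      simpleSwap j * simpleSwap i * simpleSwap j := by
    simp only [simpleSwap, hm]
    rw [Equiv.swap_mul_swap_mul_swap hab hac]
    have h := Equiv.swap_mul_swap_mul_swap hbc.symm hac.symm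
    rw [Equiv.swap_comm i.hi i.lo, Equiv.swap_comm j.hi i.hi] at h
    rw [h, Equiv.swap_comm]
  have E : ∀ k : Fin r → Fin n,
      ((k ∘ simpleSwap i) ∘ simpleSwap j) ∘ simpleSwap i =
      ((k ∘ simpleSwap j) ∘ simpleSwap i) ∘ simpleSwap j := fun k => by
    funext p
    exact congrArg k (DFunLike.congr_fun key p)
  have I1 : ∀ k : Fin r → Fin n, (k ∘ simpleSwap i) i.lo = k i.hi := by simp [simpleSwap]
  have I2 : ∀ k : Fin r → Fin n, (k ∘ simpleSwap i) i.hi = k i.lo := by simp [simpleSwap]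
  have I3 : ∀ k : Fin r → Fin n, (k ∘ simpleSwap i) j.hi = k j.hi := by
    simp [simpleSwap, Equiv.swap_apply_of_ne_of_ne hac.symm hbc.symm]
  have J1 : ∀ k : Fin r → Fin n, (k ∘ simpleSwap j) i.hi = k j.hi := by simp [simpleSwap, hm]
  have J2 : ∀ k : Fin r → Fin n, (k ∘ simpleSwap j) j.hi = k i.hi := by simp [simpleSwap, hm]
  have J3 : ∀ k : Fin r → Fin n, (k ∘ simpleSwap j) i.lo = k i.lo := by
    simp [simpleSwap, hm, Equiv.swap_apply_of_ne_of_ne hab hac]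
  have II : ∀ k : Fin r → Fin n, (k ∘ simpleSwap i) ∘ simpleSwap i = k := by
    intro k; funext p; simp [simpleSwap]
  have JJ : ∀ k : Fin r → Fin n, (k ∘ simpleSwap j) ∘ simpleSwap j = k := by
    intro k; funext p; simp [simpleSwap]
  have Es : ∀ k : Fin r → Fin n, k i.lo = k i.hi → k ∘ simpleSwap i = k := by
    intro k hk
    funext p
    by_cases h1 : p = i.lo
    · simp [simpleSwap, h1, hk]
    by_cases h2 : p = i.hi
    · simp [simpleSwap, h2, hk]
    · simp [simpleSwap, Equiv.swap_apply_of_ne_of_ne h1 h2]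
  have Et : ∀ k : Fin r → Fin n, k i.hi = k j.hi → k ∘ simpleSwap j = k := by
    intro k hk
    funext p
    by_cases h1 : p = i.hi
    · simp [simpleSwap, hm, h1, hk]
    by_cases h2 : p = j.hi
    · simp [simpleSwap, hm, h2, hk]
    · simp [simpleSwap, hm, Equiv.swap_apply_of_ne_of_ne h1 h2]
  refine (ξ R).ext fun k => ?_
  have A1 : k i.lo = k i.hi →
      ((k ∘ simpleSwap j) ∘ simpleSwap i) ∘ simpleSwap j = (k ∘ simpleSwap j) ∘ simpleSwap i := by
    intro h1
    rw [← E, Es k h1]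
  have A2 : k i.lo = k j.hi → (k ∘ simpleSwap i) ∘ simpleSwap j = k ∘ simpleSwap i := by
    intro h1
    exact Et _ (by rw [I2, I3, h1])
  have A3 : k i.lo = k j.hi → (k ∘ simpleSwap j) ∘ simpleSwap i = k ∘ simpleSwap j := by
    intro h1
    exact Es _ (by rw [J1, J3, h1])
  simp only [Module.End.mul_apply]
  rcases lt_trichotomy (k i.lo) (k i.hi) with h1 | h1 | h1 <;>
  rcases lt_trichotomy (k i.hi) (k j.hi) with h2 | h2 | h2 <;>
  rcases lt_trichotomy (k i.lo) (k j.hi) with h3 | h3 | h3 <;>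
  first
  | (exfalso; omega)
  | skip
  all_goals
    have B1 := h1.not_gt
    have B2 := h2.not_gt
    have B3 := h3.not_gt
    first
    | have C1 := h1.ne
    | have C1 := A1 h1
    first
    | have C2 := h2.ne
    | skip
    first
    | have C3 := h3.ne
    | have C3 := A2 h3
    first
    | have D1 := h1.ne'
    | skip
    first
    | have D2 := h2.ne'
    | skip
    first
    | have D3 := h3.ne'
    | skip
    clear h A1 A2 A3 Es Et hab hbc hac key
    simp only [map_add, map_smul, actT_ξ, lt_self_iff_false, if_true, if_false, *]
    try module

/-- The right action of the Hecke algebra on the tensor space. -/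
def heckeAct : Hecke R q r →ₐ[R] (Module.End R (TSpace R n r))ᵐᵒᵖ :=
  RingQuot.liftAlgHom R ⟨FreeAlgebra.lift R fun i => MulOpposite.op (actT R q i), by
    intro x y h
    apply MulOpposite.unop_injective
    induction h with
    | quad i => simpa using actT_quad R q i
    | comm i j h => simpa using (actT_comm R q i j h).symm
    | braid i j h => simpa [mul_assoc] using actT_braid R q i j h⟩

instance : Module (Hecke R q r)ᵐᵒᵖ (TSpace R n r) :=
  Module.compHom _ (AlgHom.opComm (heckeAct R q (n := n) (r := r))).toRingHom

theorem Hecke.rel {x y : FreeAlgebra R (Adj r)} (h : HeckeRel R q r x y) :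
    RingQuot.mkAlgHom R (HeckeRel R q r) x = RingQuot.mkAlgHom R (HeckeRel R q r) y :=
  RingQuot.mkAlgHom_rel R h

theorem Hecke.T_quad (i : Adj r) : Hecke.T R q i * Hecke.T R q i =
    (q - 1) • Hecke.T R q i + algebraMap R _ q := by
  have h := Hecke.rel R q (HeckeRel.quad i)
  rw [map_mul, map_add, map_smul, AlgHom.commutes] at h
  exact h

theorem Hecke.T_comm (i j : Adj r) (hij : i.1 + 1 < j.1 ∨ j.1 + 1 < i.1) :
    Hecke.T R q i * Hecke.T R q j = Hecke.T R q j * Hecke.T R q i := by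
  have h := Hecke.rel R q (HeckeRel.comm i j hij)
  rw [map_mul, map_mul] at h
  exact h

theorem Hecke.T_braid (i j : Adj r) (hij : j.1 = i.1 + 1) :
    Hecke.T R q i * Hecke.T R q j * Hecke.T R q i =
      Hecke.T R q j * Hecke.T R q i * Hecke.T R q j := by
  have h := Hecke.rel R q (HeckeRel.braid i j hij)
  rw [map_mul, map_mul, map_mul, map_mul] at h
  exact h

theorem op_T_smul (i : Adj r) (v : TSpace R n r) :
    MulOpposite.op (Hecke.T R q i) • v = actT R q i v := by
  have h : heckeAct R q (n := n) (Hecke.T R q i) = MulOpposite.op (actT R q i) := by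
    unfold heckeAct Hecke.T
    exact (RingQuot.liftAlgHom_mkAlgHom_apply ..).trans (FreeAlgebra.lift_ι_apply _ _)
  change (heckeAct R q (n := n) (Hecke.T R q i)).unop v = _
  rw [h, MulOpposite.unop_op]

end Hecke

/-! ### Specialization at `q = 0` -/

open Polynomial in
/-- The specialization `ℤ[q] → ℂ`, `q ↦ 0`. -/
def evZero : ℤ[X] →+* ℂ := eval₂RingHom (Int.castRingHom ℂ) 0

open Polynomial in
/-- `ℂ` as an algebra over `ℤ[q]` on which `q` acts by `0`. -/
instance algEvZero : Algebra ℤ[X] ℂ := evZero.toAlgebra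

section Spec

open Polynomial

variable (n r : ℕ)

/-- The `q`-Schur algebra over `ℤ[q]`. -/
abbrev SchurQ : Type := Schur ℤ[X] X n r

/-- The `0`-Schur algebra over `ℂ`. -/
abbrev SchurZero : Type := ℂ ⊗[ℤ[X]] SchurQ n r

variable {n r}

/-- The ring homomorphism from the generic Hecke algebra to the `0`-Hecke algebra that sends `q` to
`0` and `T_i` to `π̄_i`. -/
def specH : Hecke ℤ[X] X r →+* Hecke ℂ 0 r :=
  letI : Algebra ℤ[X] (Hecke ℂ 0 r) :=
    ((algebraMap ℂ (Hecke ℂ 0 r)).comp evZero).toAlgebra' fun c x => Algebra.commutes (evZero c) x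
  (RingQuot.liftAlgHom ℤ[X] ⟨FreeAlgebra.lift ℤ[X] (Hecke.T ℂ 0), by
    intro x y h
    have hX : ∀ p : ℤ[X], algebraMap ℤ[X] (Hecke ℂ 0 r) p = algebraMap ℂ _ (evZero p) :=
      fun _ => rfl
    induction h with
    | quad i =>
      simp only [map_mul, map_add, AlgHom.commutes, FreeAlgebra.lift_ι_apply,
        Hecke.T_quad, Algebra.smul_def, hX]
      simp [evZero]
    | comm i j h => simpa using Hecke.T_comm ℂ 0 i j h
    | braid i j h => simpa using Hecke.T_braid ℂ 0 i j h⟩ :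
    RingQuot (HeckeRel ℤ[X] X r) →ₐ[ℤ[X]] Hecke ℂ 0 r).toRingHom

theorem specH_T (i : Adj r) : specH (Hecke.T ℤ[X] X i) = Hecke.T ℂ 0 i := by
  unfold specH
  let _ : Algebra ℤ[X] (Hecke ℂ 0 r) :=
    ((algebraMap ℂ (Hecke ℂ 0 r)).comp evZero).toAlgebra' fun c x => Algebra.commutes (evZero c) x
  exact (RingQuot.liftAlgHom_mkAlgHom_apply ..).trans (FreeAlgebra.lift_ι_apply _ _)

theorem specH_xsum (l : WComp n r) : specH (xsum ℤ[X] X l) = xsum ℂ 0 l := by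
  simp only [xsum, map_sum, Hecke.Tw, map_list_prod, List.map_map]
  refine Finset.sum_congr rfl fun w _ => ?_
  congr 2
  funext i
  exact specH_T i

theorem specH_mem (l : WComp n r) (x : Hecke ℤ[X] X r) (hx : x ∈ xH ℤ[X] X l) :
    specH x ∈ xH ℂ 0 l := by
  obtain ⟨h, rfl⟩ := Submodule.mem_span_singleton.1 hx
  rw [MulOpposite.smul_eq_mul_unop, map_mul, specH_xsum]
  exact Submodule.mem_span_singleton.2 ⟨MulOpposite.op (specH h.unop), by simp⟩

/-- The specialization `⨁ x_l H_q → ⨁ x_l H_0` at `q = 0`. -/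
def specM : PermMod ℤ[X] X n r →+ PermMod ℂ 0 n r :=
  DirectSum.map fun l =>
    { toFun := fun x => ⟨specH x.1, specH_mem l x.1 x.2⟩
      map_zero' := by ext; simp
      map_add' := fun x y => by ext; simp }

/-- The standard basis element `e_A` of the `0`-Schur algebra. -/
def eA (A : NMat n r) : SchurZero n r := 1 ⊗ₜ std ℤ[X] X A

/-- `k_l = e_{D_l}` with `D_l = diag(l_1, …, l_n)`. -/
def kS (l : WComp n r) : SchurZero n r :=
  eA ⟨Matrix.diagonal l.1, by simp [Matrix.diagonal_apply, l.2]⟩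

/-- The matrix `D_l - E_{b,b} + E_{a,b}`, for `l b > 0`. -/
def moved (l : WComp n r) (a b : Fin n) (h : 0 < l.1 b) : NMat n r :=
  ⟨Matrix.diagonal l.1 - Matrix.single b b 1 + Matrix.single a b 1, by
    have hle : ∀ i j, (Matrix.single b b 1 : Matrix (Fin n) (Fin n) ℕ) i j ≤
        Matrix.diagonal l.1 i j := by
      intro i j
      rw [Matrix.single_apply]
      split_ifs with hij
      · obtain ⟨rfl, rfl⟩ := hij
        rw [Matrix.diagonal_apply_eq]
        exact h
      · exact Nat.zero_le _
    have key : ∀ c : Fin n, ∑ i, ∑ j, (Matrix.single c b 1 : Matrix (Fin n) (Fin n) ℕ) i j = 1 := by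
      intro c
      simp [Matrix.single_apply, ite_and]
    have h1 : ∑ i, ∑ j, ((Matrix.diagonal l.1 - Matrix.single b b 1 : Matrix (Fin n) (Fin n) ℕ) i j
        + (Matrix.single b b 1 : Matrix (Fin n) (Fin n) ℕ) i j) = r := by
      refine Eq.trans (Finset.sum_congr rfl fun i _ => ?_) l.2
      simp only [Matrix.sub_apply, Nat.sub_add_cancel (hle i _)]
      simp [Matrix.diagonal_apply]
    simp only [Finset.sum_add_distrib, key] at h1
    simpa only [Matrix.add_apply, Finset.sum_add_distrib, key] using h1⟩

/-- `e_i`, the sum over `l` of the elements `e_A` with `A = D_l - E_{i+1,i+1} + E_{i,i+1}`, where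
a term is zero if `l (i+1) = 0`, so that `A` has a negative entry. -/
def eS (i : Adj n) : SchurZero n r :=
  ∑ l : WComp n r, if h : 0 < l.1 i.hi then eA (moved l i.lo i.hi h) else 0

/-- `f_i`, the sum over `l` of the elements `e_A` with `A = D_l - E_{i,i} + E_{i+1,i}`, where
a term is zero if `l i = 0`, so that `A` has a negative entry. -/
def fS (i : Adj n) : SchurZero n r :=
  ∑ l : WComp n r, if h : 0 < l.1 i.lo then eA (moved l i.hi i.lo h) else 0

end Spec

/-! ### The degenerate quantum group -/

/-- The generators of `U_0(gl_n)`. -/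
inductive UGen (n : ℕ) : Type
  | e (i : Adj n)
  | f (i : Adj n)
  | k (i : Fin n)

section U

variable {n : ℕ}

/-- The generator `e_i` of the free algebra. -/
def fe (i : Adj n) : FreeAlgebra ℂ (UGen n) := FreeAlgebra.ι ℂ (UGen.e i)

/-- The generator `f_i` of the free algebra. -/
def ff (i : Adj n) : FreeAlgebra ℂ (UGen n) := FreeAlgebra.ι ℂ (UGen.f i)

/-- The generator `k_i` of the free algebra. -/
def fk (i : Fin n) : FreeAlgebra ℂ (UGen n) := FreeAlgebra.ι ℂ (UGen.k i)

/-- The defining relations of `U_0(gl_n)`. -/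
inductive URel : FreeAlgebra ℂ (UGen n) → FreeAlgebra ℂ (UGen n) → Prop
  | kk (i j : Fin n) : URel (fk i * fk j) (fk j * fk i)
  | ek_zero (i : Adj n) : URel (fe i * fk i.hi) 0
  | ke_zero (i : Adj n) : URel (fk i.lo * fe i) 0
  | ke (i : Fin n) (j : Adj n) (h : i ≠ j.lo) (h' : i ≠ j.hi) : URel (fk i * fe j) (fe j * fk i)
  | kf_zero (i : Adj n) : URel (fk i.hi * ff i) 0
  | fk_zero (i : Adj n) : URel (ff i * fk i.lo) 0
  | kf (i : Fin n) (j : Adj n) (h : i ≠ j.lo) (h' : i ≠ j.hi) : URel (fk i * ff j) (ff j * fk i)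
  | ef_same (i : Adj n) : URel (fe i * ff i - ff i * fe i) (fk i.hi - fk i.lo)
  | ef_ne (i j : Adj n) (h : i ≠ j) : URel (fe i * ff j) (ff j * fe i)
  | ee1 (i j : Adj n) (h : j.1 = i.1 + 1) : URel (fe i * fe i * fe j) (fe i * fe j * fe i)
  | ee2 (i j : Adj n) (h : j.1 = i.1 + 1) : URel (fe i * fe j * fe j) (fe j * fe i * fe j)
  | ff1 (i j : Adj n) (h : j.1 = i.1 + 1) : URel (ff j * ff i * ff i) (ff i * ff j * ff i)
  | ff2 (i j : Adj n) (h : j.1 = i.1 + 1) : URel (ff j * ff j * ff i) (ff j * ff i * ff j)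
  | ee_far (i j : Adj n) (h : i.1 + 1 < j.1 ∨ j.1 + 1 < i.1) : URel (fe i * fe j) (fe j * fe i)
  | ff_far (i j : Adj n) (h : i.1 + 1 < j.1 ∨ j.1 + 1 < i.1) : URel (ff i * ff j) (ff j * ff i)
  | eek (i j : Adj n) (h : j.1 = i.1 + 1) :
      URel (fe i * fe j * fk i.hi) (fk i.hi * fe i * fe j)
  | ffk (i j : Adj n) (h : j.1 = i.1 + 1) :
      URel (ff j * ff i * fk i.hi) (fk i.hi * ff j * ff i)

variable (n) in
/-- The degenerate quantum group `U_0(gl_n)`. -/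
def U0 : Type := RingQuot (URel (n := n))

instance : Ring (U0 n) := inferInstanceAs (Ring (RingQuot (URel (n := n))))

instance : Algebra ℂ (U0 n) := inferInstanceAs (Algebra ℂ (RingQuot (URel (n := n))))

/-- The quotient map from the free algebra. -/
def U0.mk : FreeAlgebra ℂ (UGen n) →ₐ[ℂ] U0 n := RingQuot.mkAlgHom ℂ (URel (n := n))

/-- The generators `e_i` of `U_0(gl_n)`. -/
def U0.e (i : Adj n) : U0 n := U0.mk (fe i)

/-- The generators `f_i` of `U_0(gl_n)`. -/
def U0.f (i : Adj n) : U0 n := U0.mk (ff i)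

/-- The generators `k_i` of `U_0(gl_n)`. -/
def U0.k (i : Fin n) : U0 n := U0.mk (fk i)

theorem U0.rel {x y : FreeAlgebra ℂ (UGen n)} (h : URel x y) : U0.mk x = U0.mk y :=
  RingQuot.mkAlgHom_rel ℂ h

/-- The values of the comultiplication on the generators. -/
def comulGen : UGen n → U0 n ⊗[ℂ] U0 n
  | .e i => 1 ⊗ₜ U0.e i + U0.e i ⊗ₜ U0.k i.lo
  | .f i => U0.k i.hi ⊗ₜ U0.f i + U0.f i ⊗ₜ 1
  | .k i => U0.k i ⊗ₜ U0.k i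

set_option linter.unusedSimpArgs false in
theorem lift_comulGen_rel (x y : FreeAlgebra ℂ (UGen n)) (h : URel x y) :
    FreeAlgebra.lift ℂ comulGen x = FreeAlgebra.lift ℂ comulGen y := by
  have kk : ∀ i j : Fin n, U0.k i * U0.k j = U0.k j * U0.k i := fun i j => by
    simpa [U0.k] using U0.rel (URel.kk i j)
  have ek0 : ∀ i : Adj n, U0.e i * U0.k i.hi = 0 := fun i => by
    simpa [U0.k, U0.e] using U0.rel (URel.ek_zero i)
  have ke0 : ∀ i : Adj n, U0.k i.lo * U0.e i = 0 := fun i => by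
    simpa [U0.k, U0.e] using U0.rel (URel.ke_zero i)
  have kf0 : ∀ i : Adj n, U0.k i.hi * U0.f i = 0 := fun i => by
    simpa [U0.k, U0.f] using U0.rel (URel.kf_zero i)
  have fk0 : ∀ i : Adj n, U0.f i * U0.k i.lo = 0 := fun i => by
    simpa [U0.k, U0.f] using U0.rel (URel.fk_zero i)
  have ke : ∀ (i : Fin n) (j : Adj n), i ≠ j.lo → i ≠ j.hi →
      U0.k i * U0.e j = U0.e j * U0.k i := fun i j h h' => by
    simpa [U0.k, U0.e] using U0.rel (URel.ke i j h h')
  have kf : ∀ (i : Fin n) (j : Adj n), i ≠ j.lo → i ≠ j.hi →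
      U0.k i * U0.f j = U0.f j * U0.k i := fun i j h h' => by
    simpa [U0.k, U0.f] using U0.rel (URel.kf i j h h')
  have efs : ∀ i : Adj n, U0.e i * U0.f i = U0.f i * U0.e i + (U0.k i.hi - U0.k i.lo) :=
    fun i => by
      have := U0.rel (URel.ef_same i)
      simp only [map_sub, map_mul] at this
      rw [← sub_eq_iff_eq_add']
      exact this
  have efn : ∀ i j : Adj n, i ≠ j → U0.e i * U0.f j = U0.f j * U0.e i := fun i j h => by
    simpa [U0.e, U0.f] using U0.rel (URel.ef_ne i j h)
  have lohi : ∀ i j : Adj n, j.1 = i.1 + 1 → j.lo = i.hi := fun i j h => by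
    simp [Adj.lo, Adj.hi, h]
  have ass : ∀ {a b c : U0 n}, a * b = c → ∀ x, a * (b * x) = c * x := fun h x => by
    rw [← mul_assoc, h]
  have kg : ∀ i j : Adj n, j.1 = i.1 + 1 → U0.k i.lo * U0.e j = U0.e j * U0.k i.lo :=
    fun i j h => ke _ _ (by simp only [Adj.lo, ne_eq, Fin.mk.injEq]; omega)
      (by simp only [Adj.lo, Adj.hi, ne_eq, Fin.mk.injEq]; omega)
  have kb : ∀ i j : Adj n, j.1 = i.1 + 1 → U0.k j.hi * U0.f i = U0.f i * U0.k j.hi :=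
    fun i j h => kf _ _ (by simp only [Adj.lo, Adj.hi, ne_eq, Fin.mk.injEq]; omega)
      (by simp only [Adj.hi, ne_eq, Fin.mk.injEq]; omega)
  induction h with
  | kk i j => simp [fk, comulGen, kk i j]
  | ek_zero i => simp [fe, fk, comulGen, add_mul, ek0]
  | ke_zero i => simp [fe, fk, comulGen, mul_add, ke0]
  | ke i j h h' => simp [fe, fk, comulGen, mul_add, add_mul, ke i j h h', kk i]
  | kf_zero i => simp [ff, fk, comulGen, mul_add, kf0]
  | fk_zero i => simp [ff, fk, comulGen, add_mul, fk0]
  | kf i j h h' => simp [ff, fk, comulGen, mul_add, add_mul, kf i j h h', kk i]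
  | ef_same i =>
    simp only [fe, ff, fk, comulGen, map_mul, map_sub, FreeAlgebra.lift_ι_apply, mul_add, add_mul,
      Algebra.TensorProduct.tmul_mul_tmul, efs, ek0, fk0, one_mul, mul_one, TensorProduct.tmul_add,
      TensorProduct.add_tmul, TensorProduct.tmul_sub, TensorProduct.sub_tmul,
      TensorProduct.tmul_zero, TensorProduct.zero_tmul]
    abel
  | ef_ne i j h =>
    have hx : (U0.e i * U0.k j.hi) ⊗ₜ[ℂ] (U0.k i.lo * U0.f j) =
        (U0.k j.hi * U0.e i) ⊗ₜ[ℂ] (U0.f j * U0.k i.lo) := by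
      have hij : i.1 ≠ j.1 := fun hh => h (Subtype.ext hh)
      by_cases h1 : i.1 = j.1 + 1
      · have h2 : i.lo = j.hi := lohi j i h1
        rw [← h2, ke0]
        rw [h2, kf0]
        simp
      · rw [ke j.hi i (by simp only [Adj.lo, Adj.hi, ne_eq, Fin.mk.injEq]; omega)
          (by simp only [Adj.hi, ne_eq, Fin.mk.injEq]; omega),
          kf i.lo j (by simp only [Adj.lo, ne_eq, Fin.mk.injEq]; omega)
          (by simp only [Adj.lo, Adj.hi, ne_eq, Fin.mk.injEq]; omega)]
    simp only [fe, ff, comulGen, map_mul, FreeAlgebra.lift_ι_apply, mul_add, add_mul,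
      Algebra.TensorProduct.tmul_mul_tmul, efn i j h, one_mul, mul_one, hx]
    abel
  | ee1 i j h =>
    have a1 := ass (ke0 i)
    have a2 := ass (ek0 i)
    have a3 := ass (kg i j h)
    have a4 := ass (kk i.lo i.hi)
    have a5 : U0.e i * (U0.e i * U0.e j) = U0.e i * (U0.e j * U0.e i) := by
      simpa [U0.e, mul_assoc] using U0.rel (URel.ee1 i j h)
    simp only [fe, comulGen, map_mul, FreeAlgebra.lift_ι_apply, mul_add, add_mul, lohi i j h,
      Algebra.TensorProduct.tmul_mul_tmul, one_mul, mul_one, mul_assoc, ke0 i, ek0 i, kg i j h,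
      kk i.lo i.hi, a1, a2, a3, a4, a5, zero_mul, mul_zero, TensorProduct.tmul_zero,
      TensorProduct.zero_tmul]
    abel
  | ee2 i j h =>
    have a0 : U0.k i.hi * U0.e j = 0 := lohi i j h ▸ ke0 j
    have a1 := ass a0
    have a2 := ass (ek0 i)
    have a3 := ass (kg i j h)
    have a4 := ass (kk i.hi i.lo)
    have a5 : U0.e i * (U0.e j * U0.e j) = U0.e j * (U0.e i * U0.e j) := by
      simpa [U0.e, mul_assoc] using U0.rel (URel.ee2 i j h)
    have a6 : U0.e i * (U0.e j * U0.k i.hi) = U0.k i.hi * (U0.e i * U0.e j) := by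
      simpa [U0.e, U0.k, mul_assoc] using U0.rel (URel.eek i j h)
    simp only [fe, comulGen, map_mul, FreeAlgebra.lift_ι_apply, mul_add, add_mul, lohi i j h,
      Algebra.TensorProduct.tmul_mul_tmul, one_mul, mul_one, mul_assoc, a0, ek0 i, kg i j h,
      kk i.hi i.lo, a1, a2, a3, a4, a5, a6, zero_mul, mul_zero, TensorProduct.tmul_zero,
      TensorProduct.zero_tmul]
    abel
  | ff1 i j h =>
    have a0 : U0.k j.hi * U0.k i.hi = U0.k i.hi * U0.k j.hi := kk _ _
    have a1 := ass a0
    have a2 := ass (kf0 i)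
    have a3 := ass (kb i j h)
    have a5 : U0.f j * (U0.f i * U0.f i) = U0.f i * (U0.f j * U0.f i) := by
      simpa [U0.f, mul_assoc] using U0.rel (URel.ff1 i j h)
    have a6 : U0.f j * (U0.f i * U0.k i.hi) = U0.k i.hi * (U0.f j * U0.f i) := by
      simpa [U0.f, U0.k, mul_assoc] using U0.rel (URel.ffk i j h)
    have a7 : U0.f j * U0.k i.hi = 0 := lohi i j h ▸ fk0 j
    have a8 := ass a7
    simp only [ff, comulGen, map_mul, FreeAlgebra.lift_ι_apply, mul_add, add_mul,
      Algebra.TensorProduct.tmul_mul_tmul, one_mul, mul_one, mul_assoc, a0, kf0 i, kb i j h,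
      a1, a2, a3, a5, a6, a7, a8, zero_mul, mul_zero, TensorProduct.tmul_zero,
      TensorProduct.zero_tmul]
    abel
  | ff2 i j h =>
    have a0 : U0.k j.hi * U0.k i.hi = U0.k i.hi * U0.k j.hi := kk _ _
    have a1 := ass a0
    have a2 := ass (kf0 j)
    have a3 := ass (kb i j h)
    have a5 : U0.f j * (U0.f j * U0.f i) = U0.f j * (U0.f i * U0.f j) := by
      simpa [U0.f, mul_assoc] using U0.rel (URel.ff2 i j h)
    have a7 : U0.f j * U0.k i.hi = 0 := lohi i j h ▸ fk0 j
    have a8 := ass a7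
    simp only [ff, comulGen, map_mul, FreeAlgebra.lift_ι_apply, mul_add, add_mul,
      Algebra.TensorProduct.tmul_mul_tmul, one_mul, mul_one, mul_assoc, a0, kf0 j, kb i j h,
      a1, a2, a3, a5, a7, a8, zero_mul, mul_zero, TensorProduct.tmul_zero,
      TensorProduct.zero_tmul]
    abel
  | ee_far i j h =>
    have a1 : U0.e i * U0.e j = U0.e j * U0.e i := by
      simpa [U0.e] using U0.rel (URel.ee_far i j h)
    have a2 : U0.k i.lo * U0.e j = U0.e j * U0.k i.lo :=
      ke _ _ (by simp only [Adj.lo, ne_eq, Fin.mk.injEq]; omega)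
        (by simp only [Adj.lo, Adj.hi, ne_eq, Fin.mk.injEq]; omega)
    have a3 : U0.k j.lo * U0.e i = U0.e i * U0.k j.lo :=
      ke _ _ (by simp only [Adj.lo, ne_eq, Fin.mk.injEq]; omega)
        (by simp only [Adj.lo, Adj.hi, ne_eq, Fin.mk.injEq]; omega)
    simp only [fe, comulGen, map_mul, FreeAlgebra.lift_ι_apply, mul_add, add_mul,
      Algebra.TensorProduct.tmul_mul_tmul, one_mul, mul_one, a1, a2, a3, kk j.lo i.lo]
    abel
  | ff_far i j h =>
    have a1 : U0.f i * U0.f j = U0.f j * U0.f i := by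
      simpa [U0.f] using U0.rel (URel.ff_far i j h)
    have a2 : U0.k i.hi * U0.f j = U0.f j * U0.k i.hi :=
      kf _ _ (by simp only [Adj.lo, Adj.hi, ne_eq, Fin.mk.injEq]; omega)
        (by simp only [Adj.hi, ne_eq, Fin.mk.injEq]; omega)
    have a3 : U0.k j.hi * U0.f i = U0.f i * U0.k j.hi :=
      kf _ _ (by simp only [Adj.lo, Adj.hi, ne_eq, Fin.mk.injEq]; omega)
        (by simp only [Adj.hi, ne_eq, Fin.mk.injEq]; omega)
    simp only [ff, comulGen, map_mul, FreeAlgebra.lift_ι_apply, mul_add, add_mul,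
      Algebra.TensorProduct.tmul_mul_tmul, one_mul, mul_one, a1, a2, a3, kk j.hi i.hi]
    abel
  | eek i j h =>
    have a0 : U0.k i.hi * U0.e j = 0 := lohi i j h ▸ ke0 j
    have a1 := ass a0
    have a2 := ass (ek0 i)
    have a3 := ass (kg i j h)
    have a4 := ass (kk i.hi i.lo)
    have a6 : U0.e i * (U0.e j * U0.k i.hi) = U0.k i.hi * (U0.e i * U0.e j) := by
      simpa [U0.e, U0.k, mul_assoc] using U0.rel (URel.eek i j h)
    simp only [fe, fk, comulGen, map_mul, FreeAlgebra.lift_ι_apply, mul_add, add_mul, lohi i j h,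
      Algebra.TensorProduct.tmul_mul_tmul, one_mul, mul_one, mul_assoc, a0, ek0 i, kg i j h,
      kk i.hi i.lo, a1, a2, a3, a4, a6, zero_mul, mul_zero, TensorProduct.tmul_zero,
      TensorProduct.zero_tmul]
  | ffk i j h =>
    have a0 : U0.k j.hi * U0.k i.hi = U0.k i.hi * U0.k j.hi := kk _ _
    have a1 := ass a0
    have a2 := ass (kf0 i)
    have a3 := ass (kb i j h)
    have a6 : U0.f j * (U0.f i * U0.k i.hi) = U0.k i.hi * (U0.f j * U0.f i) := by
      simpa [U0.f, U0.k, mul_assoc] using U0.rel (URel.ffk i j h)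
    have a7 : U0.f j * U0.k i.hi = 0 := lohi i j h ▸ fk0 j
    have a8 := ass a7
    simp only [ff, fk, comulGen, map_mul, FreeAlgebra.lift_ι_apply, mul_add, add_mul,
      Algebra.TensorProduct.tmul_mul_tmul, one_mul, mul_one, mul_assoc, a0, kf0 i, kb i j h,
      a1, a2, a3, a6, a7, a8, zero_mul, mul_zero, TensorProduct.tmul_zero,
      TensorProduct.zero_tmul]

/-- The comultiplication `Δ`. -/
def comul : U0 n →ₐ[ℂ] U0 n ⊗[ℂ] U0 n :=
  RingQuot.liftAlgHom ℂ ⟨FreeAlgebra.lift ℂ comulGen, lift_comulGen_rel⟩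

/-- The values of the counit on the generators. -/
def counitGen : UGen n → ℂ
  | .e _ => 0
  | .f _ => 0
  | .k _ => 1

/-- The counit `ε`. -/
def counit : U0 n →ₐ[ℂ] ℂ :=
  RingQuot.liftAlgHom ℂ ⟨FreeAlgebra.lift ℂ counitGen, by
    intro x y h
    induction h <;> simp [fe, ff, fk, counitGen]⟩

/-- The values of the natural representation on the generators, as matrices. -/
def rhoGen : UGen n → Matrix (Fin n) (Fin n) ℂ
  | .e i => Matrix.single i.lo i.hi 1
  | .f i => Matrix.single i.hi i.lo 1
  | .k i => ∑ j ∈ Finset.univ.erase i, Matrix.single j j 1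

theorem lift_rhoGen_rel (x y : FreeAlgebra ℂ (UGen n)) (h : URel x y) :
    FreeAlgebra.lift ℂ rhoGen x = FreeAlgebra.lift ℂ rhoGen y := by
  have hk : ∀ i : Fin n, ∑ j ∈ Finset.univ.erase i, Matrix.single j j (1 : ℂ) =
      1 - Matrix.single i i 1 := by
    intro i
    rw [eq_sub_iff_add_eq, Finset.sum_erase_add _ _ (Finset.mem_univ i)]
    ext a b
    simp [Matrix.sum_apply, Matrix.single_apply, Matrix.one_apply, ite_and]
  have hne : ∀ i : Adj n, i.lo ≠ i.hi := fun i => by simp [Adj.lo, Adj.hi]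
  have e0 : ∀ i j k l : Fin n, j ≠ k →
      (Matrix.single i j 1 * Matrix.single k l 1 : Matrix (Fin n) (Fin n) ℂ) = 0 :=
    fun i j k l h => Matrix.single_mul_single_of_ne _ _ _ _ h _
  have e1 : ∀ i j k : Fin n,
      (Matrix.single i j 1 * Matrix.single j k 1 : Matrix (Fin n) (Fin n) ℂ) =
        Matrix.single i k 1 := fun i j k => by simp
  have lohi : ∀ i j : Adj n, j.1 = i.1 + 1 → j.lo = i.hi ∧ i.lo ≠ j.hi ∧ i.hi ≠ j.hi :=
    fun i j h => by
      simp only [Adj.lo, Adj.hi, ne_eq, Fin.mk.injEq]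
      omega
  have far : ∀ i j : Adj n, i.1 + 1 < j.1 ∨ j.1 + 1 < i.1 → i.lo ≠ j.hi ∧ i.hi ≠ j.lo :=
    fun i j h => by
      simp only [Adj.lo, Adj.hi, ne_eq, Fin.mk.injEq]
      omega
  have ne : ∀ i j : Adj n, i ≠ j → i.lo ≠ j.lo ∧ i.hi ≠ j.hi := fun i j h => by
    have : i.1 ≠ j.1 := fun hh => h (Subtype.ext hh)
    simp only [Adj.lo, Adj.hi, ne_eq, Fin.mk.injEq]
    omega
  induction h with
  | kk i j =>
    rcases eq_or_ne i j with rfl | h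
    · rfl
    · simp [fk, rhoGen, hk, mul_sub, sub_mul, e0 _ _ _ _ h, e0 _ _ _ _ h.symm]
      abel
  | ek_zero i => simp [fe, fk, rhoGen, hk, mul_sub]
  | ke_zero i => simp [fe, fk, rhoGen, hk, sub_mul]
  | ke i j h h' =>
    simp [fe, fk, rhoGen, hk, mul_sub, sub_mul, e0 _ _ _ _ h, e0 _ _ _ _ h'.symm]
  | kf_zero i => simp [ff, fk, rhoGen, hk, sub_mul]
  | fk_zero i => simp [ff, fk, rhoGen, hk, mul_sub]
  | kf i j h h' =>
    simp [ff, fk, rhoGen, hk, mul_sub, sub_mul, e0 _ _ _ _ h', e0 _ _ _ _ h.symm]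
  | ef_same i => simp [fe, ff, fk, rhoGen, hk]
  | ef_ne i j h =>
    simp [fe, ff, rhoGen, e0 _ _ _ _ (ne i j h).2, e0 _ _ _ _ (ne i j h).1.symm]
  | ee1 i j h =>
    obtain ⟨h1, h2, h3⟩ := lohi i j h
    simp [fe, rhoGen, h1, e0 _ _ _ _ h2.symm, e0 _ _ _ _ (hne i).symm]
  | ee2 i j h =>
    obtain ⟨h1, h2, h3⟩ := lohi i j h
    simp [fe, rhoGen, h1, e0 _ _ _ _ h2.symm, e0 _ _ _ _ h3.symm]
  | ff1 i j h =>
    obtain ⟨h1, h2, h3⟩ := lohi i j h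
    simp [ff, rhoGen, h1, mul_assoc, e0 _ _ _ _ h2, e0 _ _ _ _ (hne i)]
  | ff2 i j h =>
    obtain ⟨h1, h2, h3⟩ := lohi i j h
    simp [ff, rhoGen, h1, mul_assoc, e0 _ _ _ _ h2, e0 _ _ _ _ h3]
  | ee_far i j h =>
    obtain ⟨h1, h2⟩ := far i j h
    simp [fe, rhoGen, e0 _ _ _ _ h2, e0 _ _ _ _ h1.symm]
  | ff_far i j h =>
    obtain ⟨h1, h2⟩ := far i j h
    simp [ff, rhoGen, e0 _ _ _ _ h1, e0 _ _ _ _ h2.symm]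
  | eek i j h =>
    obtain ⟨h1, h2, h3⟩ := lohi i j h
    simp [fe, fk, rhoGen, hk, h1, mul_sub, sub_mul, e0 _ _ _ _ h3.symm, e0 _ _ _ _ (hne i).symm]
  | ffk i j h =>
    obtain ⟨h1, h2, h3⟩ := lohi i j h
    simp [ff, fk, rhoGen, hk, h1, mul_sub, sub_mul, e0 _ _ _ _ h3, e0 _ _ _ _ (hne i)]

/-- The natural representation of `U_0(gl_n)` on `ℂ^n`. -/
def rhoV : U0 n →ₐ[ℂ] Module.End ℂ (Fin n → ℂ) :=
  (Matrix.toLinAlgEquiv' : Matrix (Fin n) (Fin n) ℂ ≃ₐ[ℂ] _).toAlgHom.comp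
    (RingQuot.liftAlgHom ℂ ⟨FreeAlgebra.lift ℂ rhoGen, lift_rhoGen_rel⟩)

/-- The isomorphism `V^{⊗ r} ⊗ V ≅ V^{⊗ (r + 1)}`. -/
def snocEquiv (n r : ℕ) : TSpace ℂ n r ⊗[ℂ] (Fin n → ℂ) ≃ₗ[ℂ] TSpace ℂ n (r + 1) :=
  (TensorProduct.congr (LinearEquiv.refl ℂ _)
    (PiTensorProduct.subsingletonEquiv (R := ℂ) (s := fun _ : Fin 1 => (Fin n → ℂ)) 0).symm).trans
    TensorPower.mulEquiv

/-- The representation of `U_0(gl_n)` on `V^{⊗ r}` given by the counit for `r = 0` and by the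
comultiplication for larger `r`. -/
def rhoT (n : ℕ) : (r : ℕ) → U0 n →ₐ[ℂ] Module.End ℂ (TSpace ℂ n r)
  | 0 => (Algebra.ofId ℂ (Module.End ℂ (TSpace ℂ n 0))).comp counit
  | r + 1 => (snocEquiv n r).conjAlgEquiv ℂ |>.toAlgHom.comp
      ((Module.endTensorEndAlgHom (R := ℂ) (S := ℂ) (A := ℂ)).comp
        ((Algebra.TensorProduct.map (rhoT n r) rhoV).comp comul))

end U

end ZeroSchur

end

open scoped TensorProduct DirectSum

noncomputable section

namespace ZeroSchur

/-! ### Inversions and sorting of words -/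

section Words

variable {n r : ℕ} {α : Type*} [LinearOrder α]

/-! Everything is computed on words `k : Fin r → Fin n`, which index the basis `ξ` of the tensor
space. The weakly increasing words `iword l` play the role of the generators `x_l`, and every word
arises from one of them by adjacent swaps that create an inversion (`word_induction`).

Over any base ring and any `q`, set `wordSum l k = ∑ T_w` over the `w` that carry `iword l` to `k`.
Right multiplication by `T_i` acts on these sums by the same three-case rule as on the vectors `ξ
k`. So `ξ k ↦ wordSum l k` is a homomorphism to `x_l H`, and together these maps send `ξ (iword l)`
to `gen l`. The combined map `permMap` is onto because it hits the generators. It is injective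
because the `T_w` are linearly independent. This independence follows from Matsumoto's theorem
(`prod_eq_of_isReducedWord`) and the action on the word `id`. The resulting isomorphism `permEquiv`
moves every question about `Schur` to the tensor space.

An endomorphism is determined by the images of the generators. The image of `gen l` is an
eigenvector with eigenvalue `q` for each `T_i` in the Young subgroup of `l`. Its coordinates are
therefore constant on the words with a given matrix relative to `iword l` (`repr_comp_simpleSwap`,
`eq_of_nmat_eq`). Hence the elements `std A`, which send `gen (co A)` to the orbit sum `orb A`, form
a basis for every `R` and `q` (`schurCoord_bijective`). Existence of `std A` needs the double coset
sum to be a left multiple of `x_{co A}`. The anti-automorphism `Hecke.rev` reduces this to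
membership in a right ideal (`exists_mul_xsum_eq_cosetSum`). Since the basis exists both over `ℤ[X]`
and over `ℂ`, matching the two bases gives a linear isomorphism `thetaLin`. It is multiplicative
because it is compatible with the specialization of the modules.

On the other side, iterating the comultiplication shows that `e_i` turns one letter `i+1` into `i`,
provided that no `i` stands to its right, and that `f_i` turns one `i` into `i+1`, provided that no
`i+1` stands to its left. Commutation with `T_j` reduces to the two positions that `T_j` touches
(`commute_actT_of_pair`). On an increasing word the provisos hold automatically, so `e_i` and `f_i`
give exactly the orbit sums of the matrices `moved`, and `k_i` keeps the word exactly when its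
weight vanishes at `i`. Comparison on the generators ends the proof. -/

theorem Adj.lo_lt_hi (i : Adj r) : i.lo < i.hi := by
  simp [Adj.lo, Adj.hi, Fin.lt_def]

theorem simpleSwap_lo (i : Adj r) : simpleSwap i i.lo = i.hi := Equiv.swap_apply_left _ _

theorem simpleSwap_hi (i : Adj r) : simpleSwap i i.hi = i.lo := Equiv.swap_apply_right _ _

theorem simpleSwap_of_ne {i : Adj r} {p : Fin r} (h : p ≠ i.lo) (h' : p ≠ i.hi) :
    simpleSwap i p = p := Equiv.swap_apply_of_ne_of_ne h h'

theorem simpleSwap_simpleSwap (i : Adj r) (p : Fin r) : simpleSwap i (simpleSwap i p) = p :=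
  Equiv.swap_apply_self _ _ _

theorem simpleSwap_mul_self (i : Adj r) : simpleSwap i * simpleSwap i = 1 :=
  Equiv.swap_mul_self _ _

theorem comp_simpleSwap_comp_simpleSwap {β : Type*} (k : Fin r → β) (i : Adj r) :
    (k ∘ simpleSwap i) ∘ simpleSwap i = k :=
  funext fun p => congrArg k (simpleSwap_simpleSwap i p)

theorem comp_simpleSwap_eq_self {β : Type*} {k : Fin r → β} {i : Adj r} (h : k i.lo = k i.hi) :
    k ∘ simpleSwap i = k := by
  funext p
  rcases eq_or_ne p i.lo with rfl | h1
  · simp [simpleSwap_lo, h]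
  rcases eq_or_ne p i.hi with rfl | h2
  · simp [simpleSwap_hi, h]
  · simp [simpleSwap_of_ne h1 h2]

/-- The set of inversions of a word. -/
def inversions (k : Fin r → α) : Finset (Fin r × Fin r) :=
  Finset.univ.filter fun p => p.1 < p.2 ∧ k p.2 < k p.1

/-- The number of inversions of a word. -/
def inv (k : Fin r → α) : ℕ := (inversions k).card

/-- A simple transposition preserves the order of every pair of positions except the adjacent pair
that it swaps. So the old inversions are carried along bijectively and that one pair is new. -/
theorem inv_comp_simpleSwap_of_lt {k : Fin r → α} {i : Adj r} (h : k i.lo < k i.hi) :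
    inv (k ∘ simpleSwap i) = inv k + 1 := by
  have hlt : ∀ a b : Fin r, a < b → ¬ (a = i.lo ∧ b = i.hi) → simpleSwap i a < simpleSwap i b := by
    intro a b hab hne
    simp only [simpleSwap, Equiv.swap_apply_def]
    simp only [Adj.lo, Adj.hi, Fin.lt_def, Fin.ext_iff] at *
    split_ifs <;> simp_all <;> omega
  have key : inversions (k ∘ simpleSwap i) = insert (i.lo, i.hi)
      ((inversions k).map ((simpleSwap i).prodCongr (simpleSwap i)).toEmbedding) := by
    ext ⟨a, b⟩
    have hs : ((simpleSwap i).prodCongr (simpleSwap i)).symm (a, b) =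
        (simpleSwap i a, simpleSwap i b) := by
      simp [simpleSwap]
    simp only [inversions, Finset.mem_filter, Finset.mem_univ, true_and, Finset.mem_insert,
      Finset.mem_map_equiv, hs, Function.comp, Prod.mk.injEq]
    by_cases hab : a = i.lo ∧ b = i.hi
    · obtain ⟨rfl, rfl⟩ := hab
      simp [simpleSwap_lo, simpleSwap_hi, h, i.lo_lt_hi]
    · simp only [hab, false_or]
      constructor
      · rintro ⟨h1, h2⟩
        exact ⟨hlt a b h1 hab, h2⟩
      · rintro ⟨h1, h2⟩
        refine ⟨?_, h2⟩
        have := hlt _ _ h1 (by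
          rintro ⟨h3, h4⟩
          rw [h3, h4] at h2
          exact lt_asymm h h2)
        rwa [simpleSwap_simpleSwap, simpleSwap_simpleSwap] at this
  rw [inv, key, Finset.card_insert_of_notMem, Finset.card_map, inv]
  rw [Finset.mem_map_equiv]
  simp [inversions, simpleSwap, i.lo_lt_hi.le]

theorem inv_comp_simpleSwap_of_gt {k : Fin r → α} {i : Adj r} (h : k i.hi < k i.lo) :
    inv (k ∘ simpleSwap i) + 1 = inv k := by
  rw [← inv_comp_simpleSwap_of_lt (k := k ∘ simpleSwap i) (i := i),
    comp_simpleSwap_comp_simpleSwap]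
  simpa [simpleSwap_lo, simpleSwap_hi] using h

theorem inv_comp_simpleSwap_le (k : Fin r → α) (i : Adj r) :
    inv (k ∘ simpleSwap i) ≤ inv k + 1 := by
  rcases lt_trichotomy (k i.lo) (k i.hi) with h | h | h
  · exact (inv_comp_simpleSwap_of_lt h).le
  · rw [comp_simpleSwap_eq_self h]; omega
  · have := inv_comp_simpleSwap_of_gt h
    omega

theorem exists_descent {k : Fin r → α} (h : ¬ Monotone k) : ∃ i : Adj r, k i.hi < k i.lo := by
  rcases r with _ | r
  · exact absurd (fun a => a.elim0) h
  · rw [Fin.monotone_iff_le_succ] at h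
    push Not at h
    obtain ⟨i, hi⟩ := h
    exact ⟨⟨i.1, by omega⟩, hi⟩

/-- Every word is obtained from a weakly increasing word by interchanging adjacent increasing
letters. -/
theorem word_induction {P : (Fin r → α) → Prop} (mono : ∀ k, Monotone k → P k)
    (step : ∀ (k : Fin r → α) (i : Adj r), k i.lo < k i.hi → P k → P (k ∘ simpleSwap i))
    (k : Fin r → α) : P k := by
  -- Undoing a descent lowers the number of inversions, and a word without descents is monotone.
  induction hm : inv k using Nat.strong_induction_on generalizing k with
  | _ m ih =>
    by_cases hk : Monotone k
    · exact mono k hk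
    · obtain ⟨i, hi⟩ := exists_descent hk
      have := inv_comp_simpleSwap_of_gt hi
      rw [← comp_simpleSwap_comp_simpleSwap k i]
      refine step _ i ?_ (ih _ (by omega) _ rfl)
      simpa [simpleSwap_lo, simpleSwap_hi] using hi

theorem inv_eq_zero {k : Fin r → α} (h : Monotone k) : inv k = 0 := by
  rw [inv, inversions, Finset.card_eq_zero, Finset.filter_eq_empty_iff]
  rintro p - ⟨h1, h2⟩
  exact absurd (h h1.le) (not_le.2 h2)

/-- Bijections between corresponding fibres are glued to a permutation of the positions. -/
theorem exists_perm_of_card_fiber_eq {β : Type*} [DecidableEq β] (f g : Fin r → β)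
    (h : ∀ b, (Finset.univ.filter fun p => f p = b).card =
      (Finset.univ.filter fun p => g p = b).card) :
    ∃ w : Equiv.Perm (Fin r), f ∘ w = g := by
  have hE : ∀ b, Nonempty ({p // g p = b} ≃ {p // f p = b}) := by
    intro b
    rw [← Fintype.card_eq, Fintype.card_subtype, Fintype.card_subtype, h]
  let E := fun b => (hE b).some
  refine ⟨(Equiv.sigmaFiberEquiv g).symm.trans
    ((Equiv.sigmaCongrRight E).trans (Equiv.sigmaFiberEquiv f)), ?_⟩
  funext p
  exact (E (g p) ⟨p, rfl⟩).2

theorem perm_eq_one_of_monotone {w : Equiv.Perm (Fin r)} (h : Monotone w) : w = 1 := by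
  have := Tuple.unique_monotone (f := (id : Fin r → Fin r)) (σ := w) (τ := 1) h
    (by intro a b hab; exact hab)
  ext p
  exact congrArg Fin.val (congrFun this p)

end Words

/-! ### Weights -/

section Weights

variable {n r : ℕ}

/-- A position is the sum of the preceding block sizes plus an offset inside its block. If the
letter at `p` exceeded the one at `p'`, the blocks before `p` would include all of the block of
`p'`, which forces `p' < p`. -/
theorem iword_monotone (l : WComp n r) : Monotone (iword l) := by
  obtain ⟨l, rfl⟩ := l
  intro p p' hp
  by_contra hlt
  rw [not_le] at hlt
  simp only [iword, Fin.cast_eq_self] at hlt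
  set x := finSigmaFinEquiv.symm p with hx
  set x' := finSigmaFinEquiv.symm p' with hx'
  have e := finSigmaFinEquiv_apply x
  have e' := finSigmaFinEquiv_apply x'
  rw [hx, Equiv.apply_symm_apply, ← hx] at e
  rw [hx', Equiv.apply_symm_apply, ← hx'] at e'
  -- Extension by zero to all naturals, so that partial sums over different `Fin j` become
  -- comparable sums over ranges.
  let N : ℕ → ℕ := fun y => if h : y < n then l ⟨y, h⟩ else 0
  have hN : ∀ j : Fin n, ∑ i : Fin j.1, l (Fin.castLE j.2.le i) = ∑ y ∈ Finset.range j.1, N y := by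
    intro j
    rw [← Fin.sum_univ_eq_sum_range]
    refine Finset.sum_congr rfl fun i _ => ?_
    simp only [N, dif_pos (i.2.trans j.2)]
    rfl
  rw [hN] at e e'
  have h1 : x'.2.1 < N x'.1 := by
    simp only [N, dif_pos x'.1.2]
    exact x'.2.2
  have h2 : ∑ y ∈ Finset.range (x'.1.1 + 1), N y ≤ ∑ y ∈ Finset.range x.1.1, N y :=
    Finset.sum_le_sum_of_subset (by
      intro y hy
      simp only [Finset.mem_range] at hy ⊢
      have : x'.1.1 < x.1.1 := hlt
      omega)
  rw [Finset.sum_range_succ] at h2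
  have : p.1 ≤ p'.1 := hp
  omega

/-- The weight of a word: the number of occurrences of each letter. -/
def wt (k : Fin r → Fin n) : WComp n r :=
  ⟨fun i => (Finset.univ.filter fun p => k p = i).card, by
    rw [← Finset.card_eq_sum_card_fiberwise (f := k) (s := Finset.univ) (t := Finset.univ)
      (fun _ _ => Finset.mem_coe.2 (Finset.mem_univ _)), Finset.card_fin]⟩

theorem wt_comp (k : Fin r → Fin n) (w : Equiv.Perm (Fin r)) : wt (k ∘ w) = wt k := by
  apply Subtype.ext
  funext i
  simp only [wt]
  exact Finset.card_equiv w fun p => by simp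

theorem wt_iword (l : WComp n r) : wt (iword l) = l := by
  apply Subtype.ext
  funext i
  obtain ⟨l, rfl⟩ := l
  have : ((Finset.univ : Finset (Fin (l i))).map (Function.Embedding.sigmaMk
      (β := fun j => Fin (l j)) i)).card = l i := by simp
  simp only [wt]
  refine Eq.trans ?_ this
  refine Finset.card_equiv finSigmaFinEquiv.symm fun p => ?_
  rw [Finset.mem_filter]
  simp only [iword, Fin.cast_eq_self, Finset.mem_univ, true_and,
    Finset.mem_map, Function.Embedding.sigmaMk_apply]
  constructor
  · intro h
    exact ⟨Fin.cast (congrArg l h) (finSigmaFinEquiv.symm p).2, by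
      generalize finSigmaFinEquiv.symm p = x at *
      obtain ⟨a, b⟩ := x
      subst h
      rfl⟩
  · rintro ⟨a, h⟩
    rw [← h]

theorem exists_comp_eq_of_wt_eq {k k' : Fin r → Fin n} (h : wt k = wt k') :
    ∃ w : Equiv.Perm (Fin r), k ∘ w = k' :=
  exists_perm_of_card_fiber_eq k k' fun b => congrFun (congrArg Subtype.val h) b

theorem exists_iword_comp (k : Fin r → Fin n) : ∃ w : Equiv.Perm (Fin r), iword (wt k) ∘ w = k :=
  exists_comp_eq_of_wt_eq (wt_iword _)

/-- Both words are sorted rearrangements of one another, and sorting is unique. -/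
theorem eq_iword_of_monotone {k : Fin r → Fin n} (h : Monotone k) : k = iword (wt k) := by
  obtain ⟨w, hw⟩ := exists_iword_comp k
  rw [← hw] at h
  have := Tuple.unique_monotone (τ := 1) h (iword_monotone _)
  rw [hw] at this
  exact this

/-- The matrix that counts the positions at which the two words have a given pair of letters. -/
def wmat (k m : Fin r → Fin n) : Matrix (Fin n) (Fin n) ℕ :=
  fun i j => (Finset.univ.filter fun p => k p = i ∧ m p = j).card

theorem wmat_comp (k m : Fin r → Fin n) (w : Equiv.Perm (Fin r)) :
    wmat (k ∘ w) (m ∘ w) = wmat k m := by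
  funext i j
  exact Finset.card_equiv w fun p => by simp

theorem sum_wmat_row (k m : Fin r → Fin n) (i : Fin n) : ∑ j, wmat k m i j = (wt k).1 i := by
  simp only [wmat, wt]
  rw [Finset.card_eq_sum_card_fiberwise (f := m) (t := Finset.univ)
      (fun _ _ => Finset.mem_coe.2 (Finset.mem_univ _))]
  simp only [Finset.filter_filter]

theorem wmat_transpose (k m : Fin r → Fin n) : (wmat k m).transpose = wmat m k := by
  funext i j
  simp only [Matrix.transpose_apply, wmat, and_comm]

theorem sum_wmat_col (k m : Fin r → Fin n) (j : Fin n) : ∑ i, wmat k m i j = (wt m).1 j := by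
  rw [← sum_wmat_row m k, ← wmat_transpose]
  rfl

/-- The matrix of a pair of words as an element of `M_n(r)`. -/
def nmat (k m : Fin r → Fin n) : NMat n r :=
  ⟨wmat k m, by simp only [sum_wmat_row]; exact (wt k).2⟩

theorem ro_nmat (k m : Fin r → Fin n) : ro (nmat k m) = wt k :=
  Subtype.ext (funext (sum_wmat_row k m))

theorem co_nmat (k m : Fin r → Fin n) : co (nmat k m) = wt m :=
  Subtype.ext (funext (sum_wmat_col k m))

/-- Reindexing the positions by `w` turns the block intersections into letter counts. Double cosets
thereby become fibres of `nmat`, the form in which they meet the tensor space. -/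
theorem mem_coset_iff_nmat (A : NMat n r) (w : Equiv.Perm (Fin r)) :
    w ∈ coset A ↔ nmat (iword (ro A) ∘ w) (iword (co A)) = A := by
  rw [mem_coset_iff, ← Subtype.coe_inj, ← Matrix.ext_iff]
  refine forall_congr' fun i => forall_congr' fun j => ?_
  have : wmat (iword (ro A) ∘ w) (iword (co A)) i j = (Finset.univ.filter fun p =>
      iword (ro A) p = i ∧ iword (co A) (w⁻¹ p) = j).card :=
    Finset.card_equiv w fun p => by simp
  rw [← this]
  rfl

/-- Every matrix is the matrix of a pair of words whose second member is weakly increasing. -/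
theorem exists_nmat_eq (A : NMat n r) : ∃ k : Fin r → Fin n, nmat k (iword (co A)) = A := by
  have hc : Fintype.card ((x : Fin n × Fin n) × Fin (A.1 x.1 x.2)) = r := by
    simp only [Fintype.card_sigma, Fintype.card_fin, Fintype.sum_prod_type]
    exact A.2
  let E := (Fintype.equivFinOfCardEq hc).symm
  have h : nmat (fun p => (E p).1.1) (fun p => (E p).1.2) = A := by
    apply Subtype.ext
    funext i j
    have : ((Finset.univ : Finset (Fin (A.1 i j))).map
        (Function.Embedding.sigmaMk (β := fun x : Fin n × Fin n => Fin (A.1 x.1 x.2)) (i, j))).card =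
          A.1 i j := by simp
    refine Eq.trans ?_ this
    simp only [nmat, wmat]
    refine Finset.card_equiv E fun p => ?_
    simp only [Finset.mem_filter, Finset.mem_univ, true_and, Finset.mem_map,
      Function.Embedding.sigmaMk_apply]
    generalize E p = x
    obtain ⟨⟨a, b⟩, c⟩ := x
    constructor
    · rintro ⟨rfl, rfl⟩
      exact ⟨c, rfl⟩
    · rintro ⟨d, hd⟩
      simp only [Sigma.mk.injEq, Prod.mk.injEq] at hd
      exact ⟨hd.1.1.symm, hd.1.2.symm⟩
  have hw : wt (fun p => (E p).1.2) = wt (iword (co A)) := by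
    rw [wt_iword, ← co_nmat (fun p => (E p).1.1), h]
  obtain ⟨w, hw⟩ := exists_comp_eq_of_wt_eq hw
  refine ⟨(fun p => (E p).1.1) ∘ w, ?_⟩
  conv_rhs => rw [← h]
  rw [← hw]
  exact Subtype.ext (wmat_comp _ _ _)

/-- Two words with the same matrix relative to a weakly increasing word `m` are related by
interchanging adjacent letters at positions with the same letter in `m`. -/
theorem eq_of_nmat_eq {β : Type*} (c : (Fin r → Fin n) → β) (m : Fin r → Fin n) (hm : Monotone m)
    (hc : ∀ (i : Adj r) (k : Fin r → Fin n), m i.lo = m i.hi → c (k ∘ simpleSwap i) = c k)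
    (k k' : Fin r → Fin n) (h : nmat k m = nmat k' m) : c k = c k' := by
  -- Bubble sort inside the blocks of `m`, measured by the inversions of the lexicographic word `(m
  -- p, k p)`. Since `m` is monotone, a descent of that word is a tie in `m`, so the swap is one
  -- that `c` and the matrix ignore.
  have sort : ∀ k : Fin r → Fin n, ∃ k₁ : Fin r → Fin n, c k = c k₁ ∧ nmat k m = nmat k₁ m ∧
      Monotone fun p => toLex (m p, k₁ p) := by
    intro k
    induction hN : inv (fun p => toLex (m p, k p)) using Nat.strong_induction_on generalizing k with
    | _ N ih =>
      by_cases hk : Monotone fun p => toLex (m p, k p)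
      · exact ⟨k, rfl, rfl, hk⟩
      · obtain ⟨i, hi⟩ := exists_descent hk
        have h1 := inv_comp_simpleSwap_of_gt (k := fun p => toLex (m p, k p)) hi
        have h2 : m i.lo = m i.hi := by
          rcases Prod.Lex.toLex_lt_toLex.1 hi with h | h
          · exact absurd (hm i.lo_lt_hi.le) (not_le.2 h)
          · exact h.1.symm
        have h3 := comp_simpleSwap_eq_self h2
        have h4 : (fun p => toLex (m p, k p)) ∘ simpleSwap i =
            fun p => toLex (m p, (k ∘ simpleSwap i) p) := by
          funext p
          have := congrFun h3 p
          simp only [Function.comp] at this ⊢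
          rw [this]
        rw [h4] at h1
        obtain ⟨k₁, e1, e2, e3⟩ := ih _ (by omega) (k ∘ simpleSwap i) rfl
        refine ⟨k₁, (hc i k h2).symm.trans e1, Eq.trans (Subtype.ext ?_) e2, e3⟩
        have := wmat_comp k m (simpleSwap i)
        rw [h3] at this
        exact this.symm
  obtain ⟨k₁, a1, a2, a3⟩ := sort k
  obtain ⟨k₂, b1, b2, b3⟩ := sort k'
  rw [a1, b1]
  congr 1
  have e : nmat k₁ m = nmat k₂ m := by rw [← a2, ← b2, h]
  -- The matrix records how often each pair of letters occurs, so the two lexicographic words are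
  -- rearrangements of one another. Being sorted, they coincide.
  obtain ⟨w, hw⟩ := exists_perm_of_card_fiber_eq (fun p => toLex (m p, k₁ p))
    (fun p => toLex (m p, k₂ p)) fun b => by
      have := congrFun (congrFun (congrArg Subtype.val e) (ofLex b).2) (ofLex b).1
      simp only [nmat, wmat] at this
      convert this using 3 <;>
      · constructor
        · rintro rfl
          exact ⟨rfl, rfl⟩
        · rintro ⟨h1, h2⟩
          rw [h1, h2]
          rfl
  have := Tuple.unique_monotone (f := fun p => toLex (m p, k₁ p)) (σ := w) (τ := 1)
    (by rw [hw]; exact b3) a3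
  rw [hw] at this
  funext p
  have := congrFun this p
  simp only [Function.comp, toLex_inj, Prod.mk.injEq] at this
  exact this.2.symm

end Weights

/-! ### Reduced words -/

section Reduced

variable {r : ℕ}

theorem coe_mul_simpleSwap (w : Equiv.Perm (Fin r)) (i : Adj r) :
    ⇑(w * simpleSwap i) = w ∘ simpleSwap i := rfl

theorem inv_prod_le (L : List (Adj r)) : inv (L.map simpleSwap).prod ≤ L.length := by
  induction L using List.reverseRecOn with
  | nil =>
    refine (inv_eq_zero ?_).le
    intro a b h
    exact h
  | append_singleton L i ih =>
    simp only [List.map_append, List.map_cons, List.map_nil, List.prod_append, List.prod_cons,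
      List.prod_nil, mul_one, List.length_append, List.length_cons, List.length_nil]
    rw [coe_mul_simpleSwap]
    exact (inv_comp_simpleSwap_le _ i).trans (Nat.succ_le_succ ih)

theorem exists_word_length_eq_inv (w : Equiv.Perm (Fin r)) :
    ∃ L : List (Adj r), (L.map simpleSwap).prod = w ∧ L.length = inv w := by
  induction hm : inv w using Nat.strong_induction_on generalizing w with
  | _ m ih =>
    by_cases hw : Monotone w
    · refine ⟨[], (perm_eq_one_of_monotone hw).symm, ?_⟩
      rw [← hm, inv_eq_zero hw]
      rfl
    · obtain ⟨i, hi⟩ := exists_descent hw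
      have h1 := inv_comp_simpleSwap_of_gt hi
      obtain ⟨L, hL, hlen⟩ := ih _ (by rw [coe_mul_simpleSwap]; omega) (w * simpleSwap i) rfl
      refine ⟨L ++ [i], ?_, ?_⟩
      · simp [hL, mul_assoc, simpleSwap_mul_self]
      · rw [List.length_append, hlen, ← hm, ← h1]
        rfl

/-- Each factor adds at most one inversion, and removing descents one at a time produces a word that
attains the bound. So the minimal length is the number of inversions. -/
theorem isReducedWord_iff {w : Equiv.Perm (Fin r)} {L : List (Adj r)} :
    IsReducedWord w L ↔ (L.map simpleSwap).prod = w ∧ L.length = inv w := by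
  constructor
  · rintro ⟨h1, h2⟩
    obtain ⟨L', h3, h4⟩ := exists_word_length_eq_inv w
    refine ⟨h1, le_antisymm (h4 ▸ h2 L' h3) ?_⟩
    rw [← h1]
    exact inv_prod_le L
  · rintro ⟨h1, h2⟩
    refine ⟨h1, fun L' h3 => ?_⟩
    rw [h2, ← h3]
    exact inv_prod_le L'

theorem reducedWord_spec (w : Equiv.Perm (Fin r)) : IsReducedWord w (reducedWord w) :=
  (exists_reducedWord w).choose_spec

theorem IsReducedWord.append {w : Equiv.Perm (Fin r)} {L : List (Adj r)} (h : IsReducedWord w L)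
    {i : Adj r} (hi : w i.lo < w i.hi) : IsReducedWord (w * simpleSwap i) (L ++ [i]) := by
  rw [isReducedWord_iff] at h ⊢
  refine ⟨by simp [h.1], ?_⟩
  rw [coe_mul_simpleSwap, inv_comp_simpleSwap_of_lt hi]
  simp [h.2]

/-- At an ascent of `w`, the product of `L` would have more inversions than `L` has letters. -/
theorem IsReducedWord.of_append {w : Equiv.Perm (Fin r)} {L : List (Adj r)} {i : Adj r}
    (h : IsReducedWord w (L ++ [i])) :
    w i.hi < w i.lo ∧ IsReducedWord (w * simpleSwap i) L := by
  rw [isReducedWord_iff] at h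
  obtain ⟨h1, h2⟩ := h
  have h3 : (L.map simpleSwap).prod = w * simpleSwap i := by
    rw [← h1]
    simp [mul_assoc, simpleSwap_mul_self]
  have h4 := inv_prod_le L
  rw [h3, coe_mul_simpleSwap] at h4
  simp only [List.length_append, List.length_cons, List.length_nil] at h2
  have h5 : w i.hi < w i.lo := by
    rcases lt_trichotomy (w i.lo) (w i.hi) with h | h | h
    · have := inv_comp_simpleSwap_of_lt h
      omega
    · exact absurd (w.injective h) i.lo_lt_hi.ne
    · exact h
  refine ⟨h5, isReducedWord_iff.2 ⟨h3, ?_⟩⟩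
  have := inv_comp_simpleSwap_of_gt h5
  rw [coe_mul_simpleSwap]
  omega

theorem IsReducedWord.reverse {w : Equiv.Perm (Fin r)} {L : List (Adj r)} (h : IsReducedWord w L) :
    IsReducedWord w⁻¹ L.reverse := by
  have key : ∀ L : List (Adj r), (L.reverse.map simpleSwap).prod = (L.map simpleSwap).prod⁻¹ := by
    intro L
    rw [List.prod_inv_reverse, List.map_reverse, List.map_map]
    congr 2
  refine ⟨by rw [key, h.1], fun L' h' => ?_⟩
  have := h.2 L'.reverse (by rw [key, h', inv_inv])
  simpa using this

theorem simpleSwap_comm {i j : Adj r} (h : i.1 + 1 < j.1 ∨ j.1 + 1 < i.1) :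
    simpleSwap i * simpleSwap j = simpleSwap j * simpleSwap i :=
  (Equiv.Perm.disjoint_swap_swap (by simp [Adj.lo, Adj.hi]; omega)).commute

theorem simpleSwap_braid {i j : Adj r} (h : j.1 = i.1 + 1) :
    simpleSwap i * simpleSwap j * simpleSwap i = simpleSwap j * simpleSwap i * simpleSwap j := by
  have hm : j.lo = i.hi := by simp [Adj.lo, Adj.hi, h]
  have hab : i.lo ≠ i.hi := i.lo_lt_hi.ne
  have hbc : i.hi ≠ j.hi := by simp [Adj.hi, h]
  have hac : i.lo ≠ j.hi := by
    simp only [Adj.lo, Adj.hi, ne_eq, Fin.mk.injEq]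
    omega
  simp only [simpleSwap, hm]
  rw [Equiv.swap_mul_swap_mul_swap hab hac]
  have h := Equiv.swap_mul_swap_mul_swap hbc.symm hac.symm
  rw [Equiv.swap_comm i.hi i.lo, Equiv.swap_comm j.hi i.hi] at h
  rw [h, Equiv.swap_comm]

/-- Matsumoto's theorem for the symmetric group: a family in a monoid that satisfies the braid
relations has the same product over any two reduced words of a permutation. -/
theorem prod_eq_of_isReducedWord {M : Type*} [Monoid M] (T : Adj r → M)
    (comm : ∀ i j : Adj r, i.1 + 1 < j.1 ∨ j.1 + 1 < i.1 → T i * T j = T j * T i)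
    (braid : ∀ i j : Adj r, j.1 = i.1 + 1 → T i * T j * T i = T j * T i * T j)
    {w : Equiv.Perm (Fin r)} {L L' : List (Adj r)} (h : IsReducedWord w L)
    (h' : IsReducedWord w L') : (L.map T).prod = (L'.map T).prod := by
  induction hm : L.length using Nat.strong_induction_on generalizing w L L' with
  | _ m ih =>
    have hlen : L.length = L'.length :=
      (isReducedWord_iff.1 h).2.trans (isReducedWord_iff.1 h').2.symm
    rcases List.eq_nil_or_concat' L with rfl | ⟨L, i, rfl⟩
    · rw [List.eq_nil_of_length_eq_zero hlen.symm]
    rcases List.eq_nil_or_concat' L' with rfl | ⟨L', j, rfl⟩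
    · simp at hlen
    simp only [List.length_append, List.length_cons, List.length_nil] at hm hlen
    obtain ⟨hi, hL⟩ := h.of_append
    obtain ⟨hj, hL'⟩ := h'.of_append
    clear h h'
    simp only [List.map_append, List.map_cons, List.map_nil, List.prod_append, List.prod_cons,
      List.prod_nil, mul_one]
    -- Distant last letters: both descents of `w` can be removed independently. A reduced word `L₂`
    -- of `w s_i s_j` extends by `j` and by `i` to reduced words of `w s_i` and `w s_j`, to which
    -- the induction hypothesis compares `L` and `L'`.
    have far : ∀ {L L' : List (Adj r)} {i j : Adj r}, L.length + 1 = m → L'.length + 1 = m →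
        w i.hi < w i.lo → IsReducedWord (w * simpleSwap i) L →
        w j.hi < w j.lo → IsReducedWord (w * simpleSwap j) L' →
        (i.1 + 1 < j.1 ∨ j.1 + 1 < i.1) → (L.map T).prod * T i = (L'.map T).prod * T j := by
      intro L L' i j hm hm' hi hL hj hL' hij
      have hne : i.lo ≠ j.lo ∧ i.lo ≠ j.hi ∧ i.hi ≠ j.lo ∧ i.hi ≠ j.hi := by
        simp only [Adj.lo, Adj.hi, ne_eq, Fin.mk.injEq]; omega
      obtain ⟨a, b, c, d⟩ := hne
      obtain ⟨L₂, hL₂⟩ := exists_reducedWord (w * simpleSwap i * simpleSwap j)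
      have e1 : IsReducedWord (w * simpleSwap i) (L₂ ++ [j]) := by
        have := hL₂.append (i := j) (by
          simpa [simpleSwap_lo, simpleSwap_hi, simpleSwap_of_ne a.symm c.symm,
            simpleSwap_of_ne b.symm d.symm] using hj)
        rwa [mul_assoc, simpleSwap_mul_self, mul_one] at this
      have e2 : IsReducedWord (w * simpleSwap j) (L₂ ++ [i]) := by
        rw [mul_assoc, simpleSwap_comm hij, ← mul_assoc] at hL₂
        have := hL₂.append (i := i) (by
          simpa [simpleSwap_lo, simpleSwap_hi, simpleSwap_of_ne a b,
            simpleSwap_of_ne c d] using hi)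
        rwa [mul_assoc, simpleSwap_mul_self, mul_one] at this
      rw [ih _ (by omega) hL e1 rfl, ih _ (by omega) hL' e2 rfl]
      simp only [List.map_append, List.map_cons, List.map_nil, List.prod_append, List.prod_cons,
        List.prod_nil, mul_one, mul_assoc]
      rw [comm i j hij]
    -- Adjacent last letters: `w` is decreasing on three consecutive positions, so the longest
    -- element `s_i s_j s_i` of that copy of `S_3` can be split off. Its two reduced words give the
    -- extensions `L₂ i j` and `L₂ j i`, and the braid relation compares the products.
    have near : ∀ {L L' : List (Adj r)} {i j : Adj r}, L.length + 1 = m → L'.length + 1 = m →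
        w i.hi < w i.lo → IsReducedWord (w * simpleSwap i) L →
        w j.hi < w j.lo → IsReducedWord (w * simpleSwap j) L' →
        j.1 = i.1 + 1 → (L.map T).prod * T i = (L'.map T).prod * T j := by
      intro L L' i j hm hm' hi hL hj hL' hij
      have hjl : j.lo = i.hi := by simp [Adj.lo, Adj.hi, hij]
      have hab : i.lo ≠ i.hi := i.lo_lt_hi.ne
      have hbc : i.hi ≠ j.hi := by simp [Adj.hi, hij]
      have hac : i.lo ≠ j.hi := by
        simp only [Adj.lo, Adj.hi, ne_eq, Fin.mk.injEq]
        omega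
      have s1 : simpleSwap j i.lo = i.lo := simpleSwap_of_ne (hjl ▸ hab) hac
      have s2 : simpleSwap i j.hi = j.hi := simpleSwap_of_ne hac.symm hbc.symm
      have s3 : simpleSwap j i.hi = j.hi := hjl ▸ simpleSwap_lo j
      have s4 : simpleSwap j j.hi = i.hi := hjl ▸ simpleSwap_hi j
      rw [hjl] at hj
      obtain ⟨L₂, hL₂⟩ := exists_reducedWord (w * simpleSwap i * simpleSwap j * simpleSwap i)
      have e1 : IsReducedWord (w * simpleSwap i) (L₂ ++ [i] ++ [j]) := by
        have h1 := hL₂.append (i := i) (by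
          simpa [simpleSwap_lo, simpleSwap_hi, s1, s2, s3, s4] using hj)
        rw [mul_assoc, simpleSwap_mul_self, mul_one] at h1
        have h2 := h1.append (i := j) (by
          simpa [simpleSwap_lo, simpleSwap_hi, s1, s2, s3, s4, hjl] using hj.trans hi)
        rwa [mul_assoc, simpleSwap_mul_self, mul_one] at h2
      have e2 : IsReducedWord (w * simpleSwap j) (L₂ ++ [j] ++ [i]) := by
        rw [mul_assoc, mul_assoc, ← mul_assoc (simpleSwap i), simpleSwap_braid hij, ← mul_assoc,
          ← mul_assoc] at hL₂
        have h1 := hL₂.append (i := j) (by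
          simpa [simpleSwap_lo, simpleSwap_hi, s1, s2, s3, s4, hjl] using hi)
        rw [mul_assoc, simpleSwap_mul_self, mul_one] at h1
        have h2 := h1.append (i := i) (by
          simpa [simpleSwap_lo, simpleSwap_hi, s1, s2, s3, s4] using hj.trans hi)
        rwa [mul_assoc, simpleSwap_mul_self, mul_one] at h2
      rw [ih _ (by omega) hL e1 rfl, ih _ (by omega) hL' e2 rfl]
      simp only [List.map_append, List.map_cons, List.map_nil, List.prod_append, List.prod_cons,
        List.prod_nil, mul_one, mul_assoc]
      rw [← mul_assoc (T i), braid i j hij, mul_assoc]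
    rcases lt_trichotomy i.1 j.1 with hij | hij | hij
    · by_cases h1 : j.1 = i.1 + 1
      · exact near hm (by omega) hi hL hj hL' h1
      · exact far hm (by omega) hi hL hj hL' (by omega)
    · obtain rfl : i = j := Subtype.ext hij
      rw [ih _ (by omega) hL hL' rfl]
    · by_cases h1 : i.1 = j.1 + 1
      · exact (near (by omega) hm hj hL' hi hL h1).symm
      · exact far hm (by omega) hi hL hj hL' (by omega)

end Reduced

/-! ### Multiplication in the Hecke algebra -/

section HeckeMul

variable (R : Type) [CommRing R] (q : R) {n r : ℕ}

theorem Hecke.Tw_eq {w : Equiv.Perm (Fin r)} {L : List (Adj r)} (h : IsReducedWord w L) :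
    Hecke.Tw R q w = (L.map (Hecke.T R q)).prod :=
  prod_eq_of_isReducedWord _ (Hecke.T_comm R q) (Hecke.T_braid R q) (reducedWord_spec w) h

theorem Hecke.Tw_mul_T_of_lt {w : Equiv.Perm (Fin r)} {i : Adj r} (h : w i.lo < w i.hi) :
    Hecke.Tw R q w * Hecke.T R q i = Hecke.Tw R q (w * simpleSwap i) := by
  rw [Hecke.Tw_eq R q ((reducedWord_spec w).append h), Hecke.Tw]
  simp

variable {R q} in
theorem Hecke.induction {P : Hecke R q r → Prop} (algebraMap : ∀ c : R, P (algebraMap R _ c))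
    (T : ∀ i, P (Hecke.T R q i)) (mul : ∀ x y, P x → P y → P (x * y))
    (add : ∀ x y, P x → P y → P (x + y)) (x : Hecke R q r) : P x := by
  obtain ⟨y, rfl⟩ := RingQuot.mkAlgHom_surjective R (HeckeRel R q r) x
  induction y using FreeAlgebra.induction with
  | grade0 c =>
    rw [AlgHom.commutes]
    exact algebraMap c
  | grade1 i => exact T i
  | mul a b ha hb => rw [map_mul]; exact mul _ _ ha hb
  | add a b ha hb => rw [map_add]; exact add _ _ ha hb

/-- The anti-automorphism of the Hecke algebra that fixes the generators. -/
def Hecke.rev : Hecke R q r →ₐ[R] (Hecke R q r)ᵐᵒᵖ :=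
  RingQuot.liftAlgHom R ⟨FreeAlgebra.lift R fun i => MulOpposite.op (Hecke.T R q i), by
    intro x y h
    apply MulOpposite.unop_injective
    induction h with
    | quad i => simpa using Hecke.T_quad R q i
    | comm i j h => simpa using (Hecke.T_comm R q i j h).symm
    | braid i j h => simpa [mul_assoc] using Hecke.T_braid R q i j h⟩

theorem Hecke.rev_T (i : Adj r) : Hecke.rev R q (Hecke.T R q i) = MulOpposite.op (Hecke.T R q i) :=
  (RingQuot.liftAlgHom_mkAlgHom_apply ..).trans (FreeAlgebra.lift_ι_apply _ _)

/-- A reduced word of `w` read backwards is a reduced word of the inverse. -/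
theorem Hecke.rev_Tw (w : Equiv.Perm (Fin r)) :
    Hecke.rev R q (Hecke.Tw R q w) = MulOpposite.op (Hecke.Tw R q w⁻¹) := by
  rw [Hecke.Tw_eq R q (reducedWord_spec w).reverse, Hecke.Tw, map_list_prod,
    ← MulOpposite.unop_inj, MulOpposite.unop_op, MulOpposite.unop_list_prod, List.map_map,
    List.map_map, List.map_reverse]
  congr 2
  refine List.map_congr_left fun i _ => ?_
  simp [Hecke.rev_T]

end HeckeMul

/-! ### The permutation module and the tensor space -/

section Perm

variable (R : Type) [CommRing R] (q : R) {n r : ℕ}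

instance : IsScalarTower R (Hecke R q r)ᵐᵒᵖ (TSpace R n r) where
  smul_assoc c h v := by
    change (heckeAct R q (n := n) (c • h.unop)).unop v = c • (heckeAct R q (n := n) h.unop).unop v
    rw [map_smul]
    rfl

variable {R q} in
/-- A linear map that commutes with the generators of the Hecke algebra commutes with the whole
algebra. -/
theorem map_op_smul {M N : Type*} [AddCommGroup M] [Module R M] [Module (Hecke R q r)ᵐᵒᵖ M]
    [IsScalarTower R (Hecke R q r)ᵐᵒᵖ M] [AddCommGroup N] [Module R N]
    [Module (Hecke R q r)ᵐᵒᵖ N] [IsScalarTower R (Hecke R q r)ᵐᵒᵖ N] (f : M →ₗ[R] N)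
    (hf : ∀ (i : Adj r) (m : M),
      f (MulOpposite.op (Hecke.T R q i) • m) = MulOpposite.op (Hecke.T R q i) • f m)
    (h : (Hecke R q r)ᵐᵒᵖ) (m : M) : f (h • m) = h • f m := by
  induction h using MulOpposite.rec' with | _ h
  induction h using Hecke.induction generalizing m with
  | algebraMap c =>
    have e : MulOpposite.op (algebraMap R (Hecke R q r) c) = c • (1 : (Hecke R q r)ᵐᵒᵖ) := by
      rw [Algebra.algebraMap_eq_smul_one, MulOpposite.op_smul, MulOpposite.op_one]
    rw [e, smul_assoc, smul_assoc, one_smul, one_smul, map_smul]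
  | T i => exact hf i m
  | mul x y hx hy => rw [MulOpposite.op_mul, mul_smul, mul_smul, hy, hx]
  | add x y hx hy => rw [MulOpposite.op_add, add_smul, add_smul, map_add, hx, hy]

/-- The sum of the `T_w` over all `w` that transform the weakly increasing word of weight `l` into
`k`. -/
def wordSum (l : WComp n r) (k : Fin r → Fin n) : Hecke R q r :=
  ∑ w ∈ Finset.univ.filter (fun w : Equiv.Perm (Fin r) => iword l ∘ w = k), Hecke.Tw R q w

/-- As `iword l` is monotone, an ascent of `k` at `i` is an ascent of every `w` in the sum, so each
`T_w T_i` is simply `T_{w s_i}`. This lemma and the two after it reproduce the three cases of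
`actT_ξ`. -/
theorem wordSum_mul_T_of_lt (l : WComp n r) {k : Fin r → Fin n} {i : Adj r}
    (h : k i.lo < k i.hi) :
    wordSum R q l k * Hecke.T R q i = wordSum R q l (k ∘ simpleSwap i) := by
  rw [wordSum, wordSum, Finset.sum_mul]
  refine Finset.sum_equiv (Equiv.mulRight (simpleSwap i)) (fun w => ?_) fun w hw => ?_
  · simp only [Finset.mem_filter, Finset.mem_univ, true_and, Equiv.coe_mulRight,
      coe_mul_simpleSwap, ← Function.comp_assoc]
    refine ⟨fun h => by rw [h], fun h => ?_⟩
    have := congrArg (· ∘ simpleSwap i) h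
    simpa only [comp_simpleSwap_comp_simpleSwap] using this
  · obtain rfl := (Finset.mem_filter.1 hw).2
    exact Hecke.Tw_mul_T_of_lt R q ((iword_monotone l).reflect_lt h)

/-- The index set is stable under right multiplication by `s_i`. Pairing each `w` that ascends at
`i` with `w s_i` splits off a right factor `1 + T_i`, and `(1 + T_i) T_i = q (1 + T_i)`. -/
theorem wordSum_mul_T_of_eq (l : WComp n r) {k : Fin r → Fin n} {i : Adj r}
    (h : k i.lo = k i.hi) :
    wordSum R q l k * Hecke.T R q i = q • wordSum R q l k := by
  have hs : wordSum R q l k = (∑ w ∈ Finset.univ.filter (fun w : Equiv.Perm (Fin r) =>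
      iword l ∘ w = k ∧ w i.lo < w i.hi), Hecke.Tw R q w) * (1 + Hecke.T R q i) := by
    rw [mul_add, mul_one, wordSum, ← Finset.sum_filter_add_sum_filter_not _
      (fun w : Equiv.Perm (Fin r) => w i.lo < w i.hi)]
    rw [Finset.filter_filter, Finset.filter_filter, Finset.sum_mul]
    congr 1
    symm
    refine Finset.sum_equiv (Equiv.mulRight (simpleSwap i)) (fun w => ?_) fun w hw => ?_
    · have e : iword l ∘ (w * simpleSwap i : Equiv.Perm (Fin r)) = k ↔ iword l ∘ w = k := by
        rw [coe_mul_simpleSwap, ← Function.comp_assoc]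
        refine ⟨fun h' => ?_, fun h' => by rw [h', comp_simpleSwap_eq_self h]⟩
        have := congrArg (· ∘ simpleSwap i) h'
        simpa only [comp_simpleSwap_comp_simpleSwap, comp_simpleSwap_eq_self h] using this
      simp only [Finset.mem_filter, Finset.mem_univ, true_and, Equiv.coe_mulRight, e,
        Equiv.Perm.mul_apply, simpleSwap_lo, simpleSwap_hi, not_lt]
      exact and_congr_right fun _ =>
        ⟨le_of_lt, fun h' => lt_of_le_of_ne h' (w.injective.ne i.lo_lt_hi.ne)⟩
    · exact Hecke.Tw_mul_T_of_lt R q (Finset.mem_filter.1 hw).2.2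
  have hq : (1 + Hecke.T R q i) * Hecke.T R q i = q • (1 + Hecke.T R q i) := by
    rw [add_mul, one_mul, Hecke.T_quad, Algebra.algebraMap_eq_smul_one]
    module
  rw [hs, mul_assoc, hq, mul_smul_comm]

/-- The ascent case for the swapped word, multiplied once more by `T_i`, reduces this to the
quadratic relation. -/
theorem wordSum_mul_T_of_gt (l : WComp n r) {k : Fin r → Fin n} {i : Adj r}
    (h : k i.hi < k i.lo) :
    wordSum R q l k * Hecke.T R q i =
      q • wordSum R q l (k ∘ simpleSwap i) + (q - 1) • wordSum R q l k := by
  have h1 := wordSum_mul_T_of_lt R q l (k := k ∘ simpleSwap i) (i := i)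
    (by simpa [simpleSwap_lo, simpleSwap_hi] using h)
  rw [comp_simpleSwap_comp_simpleSwap] at h1
  rw [← h1, mul_assoc, Hecke.T_quad, Algebra.algebraMap_eq_smul_one, mul_add, mul_smul_comm,
    mul_smul_comm, mul_one, add_comm]

open Classical in
theorem wordSum_iword (l m : WComp n r) :
    wordSum R q l (iword m) = if m = l then xsum R q l else 0 := by
  split_ifs with h
  · subst h
    rw [wordSum, xsum]
    refine Finset.sum_congr (Finset.filter_congr fun w _ => ?_) fun _ _ => rfl
    rw [funext_iff]
    rfl
  · rw [wordSum, Finset.filter_eq_empty_iff.2, Finset.sum_empty]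
    intro w _ hw
    apply h
    rw [← wt_iword m, ← hw, wt_comp, wt_iword]

theorem wordSum_mem (l : WComp n r) (k : Fin r → Fin n) : wordSum R q l k ∈ xH R q l := by
  induction k using word_induction with
  | mono k hk =>
    rw [eq_iword_of_monotone hk, wordSum_iword]
    split_ifs
    · exact Submodule.subset_span rfl
    · exact zero_mem _
  | step k i h ih =>
    rw [← wordSum_mul_T_of_lt R q l h]
    exact (xH R q l).smul_mem (MulOpposite.op (Hecke.T R q i)) ih

/-- The linear map from the tensor space to the right ideal `x_l H` that sends the increasing word
of weight `l` to `x_l`. -/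
def wordMap (l : WComp n r) : TSpace R n r →ₗ[(Hecke R q r)ᵐᵒᵖ] xH R q l where
  toFun := (ξ R).constr R fun k => (⟨wordSum R q l k, wordSum_mem R q l k⟩ : xH R q l)
  map_add' := map_add _
  map_smul' := by
    refine map_op_smul _ fun i v => ?_
    let F := (ξ R).constr R fun k => (⟨wordSum R q l k, wordSum_mem R q l k⟩ : xH R q l)
    let E : xH R q l →ₗ[R] xH R q l :=
      { toFun := fun x => MulOpposite.op (Hecke.T R q i) • x
        map_add' := smul_add _
        map_smul' := fun c x => by
          rw [smul_comm]
          rfl }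
    -- On basis vectors the three cases of the action match the three rules for `wordSum` times
    -- `T_i`.
    have : F.comp (actT R q i) = E.comp F := by
      refine (ξ R).ext fun k => Subtype.ext ?_
      simp only [LinearMap.comp_apply, actT_ξ]
      have hF : ∀ k, F (ξ R k) = ⟨wordSum R q l k, wordSum_mem R q l k⟩ := fun k =>
        (ξ R).constr_basis R _ k
      have hE : ((E (F (ξ R k)) : xH R q l) : Hecke R q r) = wordSum R q l k * Hecke.T R q i := by
        rw [hF]
        rfl
      rw [hE]
      split_ifs with h1 h2
      · rw [hF, wordSum_mul_T_of_lt R q l h1]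
      · rw [map_smul, hF, wordSum_mul_T_of_eq R q l h2]
        rfl
      · rw [map_add, map_smul, map_smul, hF, hF, wordSum_mul_T_of_gt R q l
          (lt_of_le_of_ne (not_lt.1 h1) (Ne.symm h2))]
        rfl
    rw [op_T_smul]
    exact DFunLike.congr_fun this v

theorem wordMap_ξ (l : WComp n r) (k : Fin r → Fin n) :
    ((wordMap R q l (ξ R k) : xH R q l) : Hecke R q r) = wordSum R q l k :=
  congrArg Subtype.val ((ξ R).constr_basis R _ k)

/-- Each `w` occurs in exactly one `wordSum`, that of `iword l ∘ w`, so the double sum collapses.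
The coordinates of `v` appear as coefficients of the `T_w`, which is what injectivity and the double
coset sums need. -/
theorem wordMap_apply (l : WComp n r) (v : TSpace R n r) :
    ((wordMap R q l v : xH R q l) : Hecke R q r) =
      ∑ w : Equiv.Perm (Fin r), (ξ R).repr v (iword l ∘ w) • Hecke.Tw R q w := by
  have h : ((wordMap R q l v : xH R q l) : Hecke R q r) =
      ∑ k, (ξ R).repr v k • wordSum R q l k := by
    change (((ξ R).constr R (fun k => (⟨wordSum R q l k, wordSum_mem R q l k⟩ : xH R q l)) v :
      xH R q l) : Hecke R q r) = _
    rw [(ξ R).constr_apply_fintype R]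
    simp [Module.Basis.equivFun_apply]
  rw [h]
  simp only [wordSum, Finset.smul_sum]
  rw [← Finset.sum_fiberwise (s := Finset.univ) (g := fun w : Equiv.Perm (Fin r) => iword l ∘ w)]
  refine Finset.sum_congr rfl fun k _ => Finset.sum_congr rfl fun w hw => ?_
  rw [(Finset.mem_filter.1 hw).2]

/-- No prefix gains more inversions than it has letters, so maximal gain forces every step to be an
ascent, and there `T_i` only permutes letters. -/
theorem op_prod_smul_ξ (k : Fin r → Fin n) (L : List (Adj r))
    (h : inv (k ∘ (L.map simpleSwap).prod) = inv k + L.length) :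
    MulOpposite.op (L.map (Hecke.T R q)).prod • ξ R k = ξ R (k ∘ (L.map simpleSwap).prod) := by
  have hle : ∀ L : List (Adj r), inv (k ∘ (L.map simpleSwap).prod) ≤ inv k + L.length := by
    intro L
    induction L using List.reverseRecOn with
    | nil => rfl
    | append_singleton L i ih =>
      simp only [List.map_append, List.map_cons, List.map_nil, List.prod_append, List.prod_cons,
        List.prod_nil, mul_one, List.length_append, List.length_cons, List.length_nil]
      rw [coe_mul_simpleSwap, ← Function.comp_assoc]
      exact (inv_comp_simpleSwap_le _ i).trans (Nat.succ_le_succ ih)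
  induction L using List.reverseRecOn with
  | nil =>
    simp only [List.map_nil, List.prod_nil, MulOpposite.op_one, one_smul]
    rfl
  | append_singleton L i ih =>
    simp only [List.map_append, List.map_cons, List.map_nil, List.prod_append, List.prod_cons,
      List.prod_nil, mul_one, List.length_append, List.length_cons, List.length_nil] at h ⊢
    rw [coe_mul_simpleSwap, ← Function.comp_assoc] at h ⊢
    have h1 := hle L
    have h2 := inv_comp_simpleSwap_le (k ∘ (L.map simpleSwap).prod) i
    rw [MulOpposite.op_mul, mul_smul, ih (by omega), op_T_smul, actT_ξ, if_pos]
    rcases lt_trichotomy ((k ∘ (L.map simpleSwap).prod) i.lo)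
      ((k ∘ (L.map simpleSwap).prod) i.hi) with h3 | h3 | h3
    · exact h3
    · rw [comp_simpleSwap_eq_self h3] at h
      omega
    · have := inv_comp_simpleSwap_of_gt h3
      omega

/-- In the tensor space with `n = r`, the element `T_w` sends the strictly increasing word `id` to
the basis vector of the word `w`. Distinct `w` give distinct basis vectors. -/
theorem linearIndependent_Tw : LinearIndependent R (Hecke.Tw R q (r := r)) := by
  rw [Fintype.linearIndependent_iff]
  intro c hc w
  have hw : ∀ w : Equiv.Perm (Fin r),
      MulOpposite.op (Hecke.Tw R q w) • ξ R (id : Fin r → Fin r) = ξ R (w : Fin r → Fin r) := by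
    intro w
    obtain ⟨h1, h2⟩ := isReducedWord_iff.1 (reducedWord_spec w)
    rw [Hecke.Tw, op_prod_smul_ξ, h1]
    · rfl
    · rw [h1, h2, inv_eq_zero monotone_id, zero_add]
      rfl
  have h := congrArg (fun x => MulOpposite.op x • ξ R (id : Fin r → Fin r)) hc
  simp only [Finset.op_sum, MulOpposite.op_smul, Finset.sum_smul, smul_assoc, hw,
    MulOpposite.op_zero, zero_smul] at h
  have hli : LinearIndependent R fun w : Equiv.Perm (Fin r) => ξ R (w : Fin r → Fin r) :=
    (ξ R).linearIndependent.comp _ DFunLike.coe_injective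
  exact Fintype.linearIndependent_iff.1 hli c h w

/-- The homomorphism from the tensor space to the permutation module that sends the increasing word
of weight `l` to `x_l`. -/
def permMap : TSpace R n r →ₗ[(Hecke R q r)ᵐᵒᵖ] PermMod R q n r :=
  (DirectSum.linearEquivFunOnFintype (Hecke R q r)ᵐᵒᵖ (WComp n r)
    (fun l => xH R q l)).symm.toLinearMap.comp (LinearMap.pi (wordMap R q))

theorem permMap_apply (v : TSpace R n r) (l : WComp n r) :
    permMap R q v l = wordMap R q l v := by
  have := congrFun ((DirectSum.linearEquivFunOnFintype (Hecke R q r)ᵐᵒᵖ (WComp n r)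
    (fun l => xH R q l)).apply_symm_apply (LinearMap.pi (wordMap R q) v)) l
  exact this

theorem coe_gen_apply (m l : WComp n r) :
    ((gen R q m l : xH R q l) : Hecke R q r) = if m = l then xsum R q l else 0 := by
  rw [gen]
  split_ifs with h
  · subst h
    rw [DirectSum.of_eq_same]
  · rw [DirectSum.of_eq_of_ne _ _ _ (Ne.symm h)]
    rfl

theorem permMap_ξ_iword (l : WComp n r) : permMap R q (ξ R (iword l)) = gen R q l := by
  refine DFinsupp.ext fun m => Subtype.ext ?_
  have h1 := coe_gen_apply R q l m
  have h2 := wordMap_ξ R q m (iword l)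
  rw [wordSum_iword] at h2
  refine (congrArg Subtype.val (permMap_apply R q (ξ R (iword l)) m)).trans (h2.trans ?_)
  rw [h1]

theorem span_gen : Submodule.span (Hecke R q r)ᵐᵒᵖ (Set.range (gen R q (n := n) (r := r))) = ⊤ := by
  rw [eq_top_iff]
  rintro x -
  induction x using DirectSum.induction_on with
  | zero => exact zero_mem _
  | of l x =>
    obtain ⟨x, hx⟩ := x
    obtain ⟨h, rfl⟩ := Submodule.mem_span_singleton.1 hx
    have : DirectSum.of (fun l : WComp n r => xH R q l) l ⟨h • xsum R q l, hx⟩ = h • gen R q l :=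
      (DirectSum.lof (Hecke R q r)ᵐᵒᵖ _ (fun l : WComp n r => xH R q l) l).map_smul h
        ⟨xsum R q l, Submodule.subset_span (Set.mem_singleton _)⟩
    rw [this]
    exact Submodule.smul_mem _ _ (Submodule.subset_span ⟨l, rfl⟩)
  | add x y hx hy => exact add_mem hx hy

/-- The coordinate of `v` at `k` is a coefficient of some `T_w` in the component of weight `wt k`,
so it vanishes with the image. Surjectivity holds because the generators are hit. -/
theorem permMap_bijective : Function.Bijective (permMap R q (n := n) (r := r)) := by
  constructor
  · rw [injective_iff_map_eq_zero]
    intro v hv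
    apply (ξ R).ext_elem
    intro k
    obtain ⟨w, hw⟩ := exists_iword_comp k
    have h := congrArg Subtype.val (permMap_apply R q v (wt k))
    rw [hv, wordMap_apply] at h
    rw [← hw, Fintype.linearIndependent_iff.1 (linearIndependent_Tw R q) _ h.symm w]
    simp
  · rw [← LinearMap.range_eq_top, eq_top_iff, ← span_gen, Submodule.span_le]
    rintro _ ⟨l, rfl⟩
    exact ⟨_, permMap_ξ_iword R q l⟩

/-- The isomorphism of the permutation module with the tensor space. -/
def permEquiv : PermMod R q n r ≃ₗ[(Hecke R q r)ᵐᵒᵖ] TSpace R n r :=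
  (LinearEquiv.ofBijective _ (permMap_bijective R q)).symm

theorem permEquiv_gen (l : WComp n r) : permEquiv R q (gen R q l) = ξ R (iword l) := by
  rw [permEquiv, LinearEquiv.symm_apply_eq]
  exact (permMap_ξ_iword R q l).symm

theorem permEquiv_symm_apply (v : TSpace R n r) : (permEquiv R q).symm v = permMap R q v := rfl

end Perm

/-! ### The standard basis of the Schur algebra -/

section Std

variable (R : Type) [CommRing R] (q : R) {n r : ℕ}

/-- The sum of the words whose matrix relative to the increasing word of weight `co A` is `A`. -/
def orb (A : NMat n r) : TSpace R n r :=
  ∑ k ∈ Finset.univ.filter (fun k => nmat k (iword (co A)) = A), ξ R k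

theorem repr_orb (A : NMat n r) (k : Fin r → Fin n) :
    (ξ R).repr (orb R A) k = if nmat k (iword (co A)) = A then 1 else 0 := by
  simp only [orb, map_sum, Module.Basis.repr_self, Finsupp.finsetSum_apply, Finsupp.single_apply]
  rw [Finset.sum_ite_eq']
  simp

/-- The `w` for which `iword (ro A) ∘ w` lies in the support of `orb A` form the double coset of
`A`. For `l ≠ ro A` the weights exclude every `w`. -/
theorem coe_permMap_orb (A : NMat n r) (l : WComp n r) :
    ((permMap R q (orb R A) l : xH R q l) : Hecke R q r) =
      if l = ro A then cosetSum R q A else 0 := by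
  classical
  rw [permMap_apply, wordMap_apply]
  simp only [repr_orb, ite_smul, one_smul, zero_smul]
  rw [← Finset.sum_filter]
  split_ifs with h
  · subst h
    rw [cosetSum]
    refine Finset.sum_congr (Finset.filter_congr fun w _ => ?_) fun _ _ => rfl
    rw [mem_coset_iff_nmat]
  · rw [Finset.filter_eq_empty_iff.2, Finset.sum_empty]
    intro w _ hw
    apply h
    rw [← hw, ro_nmat, wt_comp, wt_iword]

/-! ### Existence of the standard endomorphisms -/

theorem isStd_iff (A : NMat n r) (φ : Schur R q n r) :
    IsStd R q A φ ↔ ∀ l, φ (gen R q l) = if l = co A then permMap R q (orb R A) else 0 := by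
  refine forall_congr' fun l => ?_
  have h : ∀ m : WComp n r, (((if l = co A then permMap R q (orb R A) else 0 :
      PermMod R q n r) m : xH R q m) : Hecke R q r) =
        if l = co A ∧ m = ro A then cosetSum R q A else 0 := by
    intro m
    by_cases h1 : l = co A
    · rw [if_pos h1, coe_permMap_orb]
      simp only [h1, true_and]
    · rw [if_neg h1, if_neg (fun h2 => h1 h2.1)]
      rfl
  constructor
  · intro h1
    refine DFinsupp.ext fun m => Subtype.ext ?_
    exact (h1 m).trans (h m).symm
  · intro h1 m
    rw [h1, h]

/-- The double coset sum is a component of the image of `orb A`, so divisibility by `x_{ro A}` comes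
without choosing distinguished coset representatives. -/
theorem cosetSum_mem (A : NMat n r) : cosetSum R q A ∈ xH R q (ro A) := by
  have := coe_permMap_orb R q A (ro A)
  rw [if_pos rfl] at this
  rw [← this]
  exact Subtype.coe_prop _

/-- The transpose of an element of `M_n(r)`. -/
def transpose (A : NMat n r) : NMat n r :=
  ⟨A.1.transpose, by simp only [Matrix.transpose_apply]; rw [Finset.sum_comm]; exact A.2⟩

theorem inv_mem_coset_transpose (A : NMat n r) (w : Equiv.Perm (Fin r)) :
    w⁻¹ ∈ coset (transpose A) ↔ w ∈ coset A := by
  rw [mem_coset_iff_nmat, mem_coset_iff_nmat, ← Subtype.coe_inj, ← Subtype.coe_inj]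
  change wmat (iword (co A) ∘ (w⁻¹ : Equiv.Perm (Fin r))) (iword (ro A)) = A.1.transpose ↔
    wmat (iword (ro A) ∘ w) (iword (co A)) = A.1
  rw [← wmat_comp (iword (co A) ∘ (w⁻¹ : Equiv.Perm (Fin r))) _ w, ← wmat_transpose,
    Matrix.transpose_inj]
  have : (iword (co A) ∘ (w⁻¹ : Equiv.Perm (Fin r))) ∘ w = iword (co A) := by
    funext p
    simp
  rw [this]

theorem rev_cosetSum (A : NMat n r) :
    Hecke.rev R q (cosetSum R q (transpose A)) = MulOpposite.op (cosetSum R q A) := by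
  simp only [cosetSum, map_sum, Hecke.rev_Tw, Finset.op_sum]
  refine Finset.sum_equiv (Equiv.inv _) (fun w => ?_) fun _ _ => rfl
  simp only [Finset.mem_filter, Finset.mem_univ, true_and, Equiv.inv_apply]
  rw [← inv_mem_coset_transpose A, inv_inv]

theorem rev_xsum (l : WComp n r) :
    Hecke.rev R q (xsum R q l) = MulOpposite.op (xsum R q l) := by
  simp only [xsum, map_sum, Hecke.rev_Tw, Finset.op_sum]
  refine Finset.sum_equiv (Equiv.inv _) (fun w => ?_) fun _ _ => rfl
  simp

/-- The anti-automorphism turns the right ideal generated by `x_{co A}`, which contains the sum for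
the transpose, into the left ideal generated by the same element. -/
theorem exists_mul_xsum_eq_cosetSum (A : NMat n r) :
    ∃ h : Hecke R q r, h * xsum R q (co A) = cosetSum R q A := by
  obtain ⟨h, hh⟩ := Submodule.mem_span_singleton.1 (cosetSum_mem R q (transpose A))
  have := congrArg (Hecke.rev R q) hh
  rw [rev_cosetSum, MulOpposite.smul_eq_mul_unop, map_mul, rev_xsum] at this
  exact ⟨(Hecke.rev R q h.unop).unop, congrArg MulOpposite.unop this⟩

/-- Project to the summand of `co A`, multiply on the left by `h`, and include into the summand of
`ro A`. Left multiplication commutes with the right action and sends `x_{co A}` to the double coset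
sum. -/
theorem exists_isStd (A : NMat n r) : ∃ φ, IsStd R q A φ := by
  obtain ⟨h, hh⟩ := exists_mul_xsum_eq_cosetSum R q A
  have hmem : ∀ x ∈ xH R q (co A), h * x ∈ xH R q (ro A) := by
    intro x hx
    obtain ⟨y, rfl⟩ := Submodule.mem_span_singleton.1 hx
    rw [MulOpposite.smul_eq_mul_unop, ← mul_assoc, hh]
    exact (xH R q (ro A)).smul_mem y (cosetSum_mem R q A)
  let L : xH R q (co A) →ₗ[(Hecke R q r)ᵐᵒᵖ] xH R q (ro A) :=
    { toFun := fun x => ⟨h * x.1, hmem x.1 x.2⟩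
      map_add' := fun x y => Subtype.ext (mul_add h x.1 y.1)
      map_smul' := fun c x => Subtype.ext (mul_assoc h x.1 c.unop).symm }
  refine ⟨(DirectSum.lof (Hecke R q r)ᵐᵒᵖ _ (fun l : WComp n r => xH R q l) (ro A)).comp
    (L.comp (DirectSum.component (Hecke R q r)ᵐᵒᵖ _ (fun l : WComp n r => xH R q l) (co A))), ?_⟩
  intro l m
  have hc : ((gen R q l (co A) : xH R q (co A)) : Hecke R q r) = _ := coe_gen_apply R q l (co A)
  change ((DirectSum.of (fun l : WComp n r => xH R q l) (ro A) (L (gen R q l (co A))) m :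
    xH R q m) : Hecke R q r) = _
  by_cases h2 : m = ro A
  · subst h2
    rw [DirectSum.of_eq_same]
    change h * ((gen R q l (co A) : xH R q (co A)) : Hecke R q r) = _
    rw [hc]
    by_cases h1 : l = co A
    · simp [h1, hh]
    · simp [h1]
  · rw [DirectSum.of_eq_of_ne _ _ _ h2, if_neg fun h => h2 h.2]
    rfl

theorem isStd_std (A : NMat n r) : IsStd R q A (std R q A) := by
  rw [std, dif_pos (exists_isStd R q A)]
  exact (exists_isStd R q A).choose_spec

theorem std_gen (A : NMat n r) (l : WComp n r) :
    std R q A (gen R q l) = if l = co A then permMap R q (orb R A) else 0 :=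
  (isStd_iff R q A _).1 (isStd_std R q A) l

theorem permEquiv_std_gen (A : NMat n r) (l : WComp n r) :
    permEquiv R q (std R q A (gen R q l)) = if l = co A then orb R A else 0 := by
  rw [std_gen]
  split_ifs
  · rw [← permEquiv_symm_apply, LinearEquiv.apply_symm_apply]
  · exact map_zero _

variable {R q} in
theorem schur_ext {s t : Schur R q n r} (h : ∀ l, s (gen R q l) = t (gen R q l)) : s = t :=
  LinearMap.ext_on (span_gen R q) (by rintro _ ⟨l, rfl⟩; exact h l)

/-! ### Young-invariant coordinates and the basis property -/

theorem repr_actT_of_gt {k : Fin r → Fin n} {i : Adj r} (h : k i.hi < k i.lo) (v : TSpace R n r) :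
    (ξ R).repr (actT R q i v) k =
      (ξ R).repr v (k ∘ simpleSwap i) + (q - 1) * (ξ R).repr v k := by
  have key : ((ξ R).coord k).comp (actT R q i) =
      (ξ R).coord (k ∘ simpleSwap i) + (q - 1) • (ξ R).coord k := by
    refine (ξ R).ext fun k' => ?_
    simp only [LinearMap.comp_apply, LinearMap.add_apply, LinearMap.smul_apply, actT_ξ]
    have e1 : k' ∘ simpleSwap i = k ↔ k' = k ∘ simpleSwap i := by
      constructor <;> rintro rfl <;> rw [comp_simpleSwap_comp_simpleSwap]
    have e2 : k' = k ∘ simpleSwap i → k' i.lo < k' i.hi := by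
      rintro rfl
      simpa [simpleSwap_lo, simpleSwap_hi] using h
    have e3 : k' = k → k' i.hi < k' i.lo := by
      rintro rfl
      exact h
    have hx : ∀ k₁ k₂ : Fin r → Fin n, (ξ R).coord k₁ (ξ R k₂) = if k₂ = k₁ then 1 else 0 := by
      intro k₁ k₂
      rw [Module.Basis.coord_apply, Module.Basis.repr_self, Finsupp.single_apply]
    split_ifs with h1 h2
    · have e4 : k' ≠ k := fun h => lt_asymm h1 (e3 h)
      simp [hx, e1, e4]
    · have e4 : k' ≠ k := fun h => (e3 h).ne h2.symm
      have e5 : k' ≠ k ∘ simpleSwap i := fun h => h1 (e2 h)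
      simp [hx, e4, e5]
    · have e5 : k' ≠ k ∘ simpleSwap i := fun h => h1 (e2 h)
      simp only [map_add, map_smul, hx, e1, e5, if_false, smul_zero]
  simpa using DFunLike.congr_fun key v

/-- Only coordinates at descents are compared. There the eigenvalue equation reads `q v_k = v_{k s}
+ (q - 1) v_k`, which gives the claim without dividing by `q`, so `q = 0` is allowed. -/
theorem repr_comp_simpleSwap {i : Adj r} {v : TSpace R n r} (h : actT R q i v = q • v)
    (k : Fin r → Fin n) : (ξ R).repr v (k ∘ simpleSwap i) = (ξ R).repr v k := by
  have key : ∀ k : Fin r → Fin n, k i.hi < k i.lo →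
      (ξ R).repr v (k ∘ simpleSwap i) = (ξ R).repr v k := by
    intro k hk
    have := repr_actT_of_gt R q hk v
    rw [h, map_smul, Finsupp.smul_apply, smul_eq_mul] at this
    linear_combination -this
  rcases lt_trichotomy (k i.lo) (k i.hi) with hk | hk | hk
  · have := key (k ∘ simpleSwap i) (by simpa [simpleSwap_lo, simpleSwap_hi] using hk)
    rw [comp_simpleSwap_comp_simpleSwap] at this
    exact this.symm
  · rw [comp_simpleSwap_eq_self hk]
  · exact key k hk

/-- The word `iword l` itself has eigenvalue `q` under such a `T_i`, and endomorphisms preserve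
this. -/
theorem actT_schur_gen (s : Schur R q n r) (l : WComp n r) {i : Adj r}
    (h : iword l i.lo = iword l i.hi) :
    actT R q i (permEquiv R q (s (gen R q l))) = q • permEquiv R q (s (gen R q l)) := by
  let g : TSpace R n r →ₗ[(Hecke R q r)ᵐᵒᵖ] TSpace R n r :=
    (permEquiv R q).toLinearMap.comp (s.comp (permEquiv R q).symm.toLinearMap)
  have e : permEquiv R q (s (gen R q l)) = g (ξ R (iword l)) := by
    simp only [g, LinearMap.comp_apply, LinearEquiv.coe_coe, ← permEquiv_gen R q,
      LinearEquiv.symm_apply_apply]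
  rw [e, ← op_T_smul, ← map_smul, op_T_smul, actT_ξ, if_neg h.not_lt, if_pos h,
    LinearMap.map_smul_of_tower]

/-- A word whose matrix relative to the increasing word of weight `co A` is `A`. -/
def repWord (A : NMat n r) : Fin r → Fin n := (exists_nmat_eq A).choose

theorem nmat_repWord (A : NMat n r) : nmat (repWord A) (iword (co A)) = A :=
  (exists_nmat_eq A).choose_spec

/-- The coordinates with respect to the standard basis. -/
def schurCoord : Schur R q n r →ₗ[R] (NMat n r → R) :=
  LinearMap.pi fun A =>
    { toFun := fun s => (ξ R).repr (permEquiv R q (s (gen R q (co A)))) (repWord A)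
      map_add' := fun s t => by
        rw [LinearMap.add_apply, map_add, map_add, Finsupp.add_apply]
      map_smul' := fun c s => by
        have : permEquiv R q ((c • s) (gen R q (co A))) =
            c • permEquiv R q (s (gen R q (co A))) :=
          (permEquiv R q).toLinearMap.map_smul_of_tower c _
        rw [this, map_smul, Finsupp.smul_apply, RingHom.id_apply] }

theorem schurCoord_apply (s : Schur R q n r) (A : NMat n r) :
    schurCoord R q s A = (ξ R).repr (permEquiv R q (s (gen R q (co A)))) (repWord A) := rfl

theorem schurCoord_std (A : NMat n r) : schurCoord R q (std R q A) = Pi.single A 1 := by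
  funext B
  rw [schurCoord_apply, permEquiv_std_gen, Pi.single_apply]
  by_cases h : co B = co A
  · rw [if_pos h, repr_orb, ← h, nmat_repWord]
  · rw [if_neg h, if_neg (fun h' => h (congrArg co h'))]
    simp

instance : Finite (NMat n r) :=
  Finite.of_injective (fun A => (repWord A, co A)) fun A B h => by
    simp only [Prod.mk.injEq] at h
    rw [← nmat_repWord A, ← nmat_repWord B, h.1, h.2]

/-- The image of `gen l` has equal coordinates at words with the same matrix relative to `iword l`,
so one representative per matrix determines it. The elements `std A` are mapped to the unit vectors.
-/
theorem schurCoord_bijective : Function.Bijective (schurCoord R q (n := n) (r := r)) := by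
  constructor
  · intro s t hst
    refine schur_ext fun l => (permEquiv R q).injective ((ξ R).ext_elem fun k => ?_)
    have hco : co (nmat k (iword l)) = l := by rw [co_nmat, wt_iword]
    have h1 := congrFun hst (nmat k (iword l))
    rw [schurCoord_apply, schurCoord_apply, hco] at h1
    have h2 : ∀ s : Schur R q n r, (ξ R).repr (permEquiv R q (s (gen R q l))) k =
        (ξ R).repr (permEquiv R q (s (gen R q l))) (repWord (nmat k (iword l))) := by
      intro s
      refine eq_of_nmat_eq (fun k => (ξ R).repr (permEquiv R q (s (gen R q l))) k) (iword l)
        (iword_monotone l)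
        (fun i k hi => repr_comp_simpleSwap R q (actT_schur_gen R q s l hi) k) _ _ ?_
      have := nmat_repWord (nmat k (iword l))
      rw [hco] at this
      exact this.symm
    rw [h2, h2, h1]
  · classical
    have _ := Fintype.ofFinite (NMat n r)
    intro c
    refine ⟨∑ A, c A • std R q A, ?_⟩
    simp only [map_sum, map_smul, schurCoord_std]
    funext A
    simp [Finset.sum_apply, Pi.single_apply]

/-- The standard basis of the Schur algebra. -/
def stdBasis : Module.Basis (NMat n r) R (Schur R q n r) :=
  .ofEquivFun (LinearEquiv.ofBijective _ (schurCoord_bijective R q))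

theorem stdBasis_apply (A : NMat n r) : stdBasis R q A = std R q A := by
  classical
  rw [stdBasis, Module.Basis.coe_ofEquivFun, LinearEquiv.symm_apply_eq]
  refine Eq.trans ?_ (schurCoord_std R q A).symm
  congr!

end Std

/-! ### The specialization isomorphism -/

section Theta

open Polynomial

variable {n r : ℕ}

theorem specH_algebraMap (p : ℤ[X]) :
    specH (algebraMap ℤ[X] (Hecke ℤ[X] X r) p) = algebraMap ℂ (Hecke ℂ 0 r) (evZero p) := by
  unfold specH
  let _ : Algebra ℤ[X] (Hecke ℂ 0 r) :=
    ((algebraMap ℂ (Hecke ℂ 0 r)).comp evZero).toAlgebra' fun c x => Algebra.commutes (evZero c) x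
  exact AlgHom.commutes (A := RingQuot (HeckeRel ℤ[X] X r)) _ p

theorem specH_cosetSum (A : NMat n r) : specH (cosetSum ℤ[X] X A) = cosetSum ℂ 0 A := by
  simp only [cosetSum, map_sum, Hecke.Tw, map_list_prod, List.map_map]
  refine Finset.sum_congr rfl fun w _ => ?_
  congr 2
  funext i
  exact specH_T i

theorem coe_specM_apply (m : PermMod ℤ[X] X n r) (l : WComp n r) :
    ((specM m l : xH ℂ 0 l) : Hecke ℂ 0 r) = specH ((m l : xH ℤ[X] X l) : Hecke ℤ[X] X r) := by
  rw [specM, DirectSum.map_apply]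
  rfl

theorem permMod_ext {R : Type} [CommRing R] {q : R} {x y : PermMod R q n r}
    (h : ∀ l, ((x l : xH R q l) : Hecke R q r) = (y l : xH R q l)) : x = y :=
  DFinsupp.ext fun l => Subtype.ext (h l)

theorem specM_gen (l : WComp n r) : specM (gen ℤ[X] X l) = gen ℂ 0 l := by
  refine permMod_ext fun m => ?_
  rw [coe_specM_apply, coe_gen_apply, coe_gen_apply]
  split_ifs
  · exact specH_xsum _
  · exact map_zero _

theorem specM_op_smul (h : (Hecke ℤ[X] X r)ᵐᵒᵖ) (m : PermMod ℤ[X] X n r) :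
    specM (h • m) = MulOpposite.op (specH h.unop) • specM m := by
  refine permMod_ext fun l => ?_
  rw [coe_specM_apply]
  change specH (((m l : xH ℤ[X] X l) : Hecke ℤ[X] X r) * h.unop) =
    ((specM m l : xH ℂ 0 l) : Hecke ℂ 0 r) * specH h.unop
  rw [coe_specM_apply, map_mul]

theorem specM_smul (p : ℤ[X]) (m : PermMod ℤ[X] X n r) :
    specM (p • m) = evZero p • specM m := by
  refine permMod_ext fun l => ?_
  rw [coe_specM_apply]
  change specH (p • ((m l : xH ℤ[X] X l) : Hecke ℤ[X] X r)) =
    evZero p • ((specM m l : xH ℂ 0 l) : Hecke ℂ 0 r)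
  rw [coe_specM_apply, Algebra.smul_def, map_mul, specH_algebraMap, Algebra.smul_def]

/-- Both sides are semilinear along `specH`, so it suffices to compare them on generators, where the
generic double coset sum specializes to the one at zero. -/
theorem std_specM (A : NMat n r) (m : PermMod ℤ[X] X n r) :
    std ℂ 0 A (specM m) = specM (std ℤ[X] X A m) := by
  have hm : m ∈ Submodule.span (Hecke ℤ[X] X r)ᵐᵒᵖ (Set.range (gen ℤ[X] X (n := n) (r := r))) := by
    rw [span_gen]
    trivial
  induction hm using Submodule.span_induction with
  | mem x hx =>
    obtain ⟨l, rfl⟩ := hx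
    refine permMod_ext fun m => ?_
    rw [specM_gen, isStd_std ℂ 0 A l m, coe_specM_apply, isStd_std ℤ[X] X A l m]
    split_ifs
    · exact (specH_cosetSum A).symm
    · exact (map_zero _).symm
  | zero => simp only [map_zero]
  | add x y _ _ hx hy => simp only [map_add, hx, hy]
  | smul h x _ hx => rw [specM_op_smul, map_smul, hx, map_smul, specM_op_smul]

/-- The specialization isomorphism as a linear map. -/
def thetaLin : SchurZero n r ≃ₗ[ℂ] Schur ℂ 0 n r :=
  (Algebra.TensorProduct.basis ℂ (stdBasis ℤ[X] X)).equiv (stdBasis ℂ 0) (Equiv.refl _)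

theorem thetaLin_eA (A : NMat n r) : thetaLin (eA A) = std ℂ 0 A := by
  rw [← stdBasis_apply, eA, ← stdBasis_apply,
    ← Algebra.TensorProduct.basis_apply, thetaLin, Module.Basis.equiv_apply]
  rfl

/-- This frees `thetaLin` from the choice of bases: it is the action induced on the specialized
module. Multiplicativity and the unit follow from it. -/
theorem thetaLin_specM (s : SchurQ n r) (m : PermMod ℤ[X] X n r) :
    thetaLin (1 ⊗ₜ s) (specM m) = specM (s m) := by
  have hs : s ∈ Submodule.span ℤ[X] (Set.range (stdBasis ℤ[X] X (n := n) (r := r))) := by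
    rw [Module.Basis.span_eq]
    trivial
  induction hs using Submodule.span_induction with
  | mem x hx =>
    obtain ⟨A, rfl⟩ := hx
    rw [stdBasis_apply, ← std_specM, ← thetaLin_eA]
    rfl
  | zero =>
    rw [TensorProduct.tmul_zero, map_zero, LinearMap.zero_apply, LinearMap.zero_apply, map_zero]
  | add x y _ _ hx hy =>
    rw [TensorProduct.tmul_add, map_add, LinearMap.add_apply, LinearMap.add_apply, map_add, hx, hy]
  | smul p x _ hx =>
    have : (1 : ℂ) ⊗ₜ[ℤ[X]] (p • x) = evZero p • ((1 : ℂ) ⊗ₜ[ℤ[X]] x) := by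
      rw [← TensorProduct.smul_tmul, TensorProduct.smul_tmul']
      congr 1
    rw [this, map_smul, LinearMap.smul_apply, hx, LinearMap.smul_apply, specM_smul]

theorem thetaLin_mul (x y : SchurZero n r) : thetaLin (x * y) = thetaLin x * thetaLin y := by
  have h1 : ∀ (c : ℂ) (s : SchurQ n r), c ⊗ₜ[ℤ[X]] s = c • ((1 : ℂ) ⊗ₜ[ℤ[X]] s) := by
    intro c s
    rw [TensorProduct.smul_tmul', smul_eq_mul, mul_one]
  have h2 : ∀ s t : SchurQ n r, thetaLin ((1 ⊗ₜ s) * (1 ⊗ₜ t)) =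
      thetaLin (1 ⊗ₜ s) * thetaLin (1 ⊗ₜ t) := by
    intro s t
    refine schur_ext fun l => ?_
    -- The generators at `q = 0` are specializations of the generic ones, so the composite can be
    -- formed before specializing.
    rw [Algebra.TensorProduct.tmul_mul_tmul, one_mul, ← specM_gen, Module.End.mul_apply,
      thetaLin_specM, thetaLin_specM, thetaLin_specM, Module.End.mul_apply]
  induction x using TensorProduct.induction_on with
  | zero => rw [zero_mul, map_zero, zero_mul]
  | add x x' hx hx' => rw [add_mul, map_add, map_add, add_mul, hx, hx']
  | tmul c s =>
    induction y using TensorProduct.induction_on with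
    | zero => rw [mul_zero, map_zero, mul_zero]
    | add y y' hy hy' => rw [mul_add, map_add, map_add, mul_add, hy, hy']
    | tmul d t =>
      rw [h1 c, h1 d, smul_mul_smul_comm, map_smul, map_smul, map_smul, h2, smul_mul_smul_comm]

/-- The specialization isomorphism from the `0`-Schur algebra to the endomorphism algebra of the
permutation module of the `0`-Hecke algebra. -/
def theta : SchurZero n r ≃ₐ[ℂ] Schur ℂ 0 n r :=
  AlgEquiv.ofLinearEquiv thetaLin (by
    refine schur_ext fun l => ?_
    rw [Algebra.TensorProduct.one_def, ← specM_gen, thetaLin_specM]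
    rfl) thetaLin_mul

theorem theta_specM (s : SchurQ n r) (m : PermMod ℤ[X] X n r) :
    theta (1 ⊗ₜ s) (specM m) = specM (s m) := thetaLin_specM s m

theorem theta_eA (A : NMat n r) : theta (eA A) = std ℂ 0 A := thetaLin_eA A

end Theta

/-! ### The action of the degenerate quantum group on words -/

section Action

variable {n r : ℕ}

theorem ξ_apply (k : Fin r → Fin n) :
    ξ ℂ k = PiTensorProduct.tprod ℂ fun p => (Pi.single (k p) 1 : Fin n → ℂ) := by
  rw [ξ, Basis.piTensorProduct_apply]
  simp only [Pi.basisFun_apply]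

theorem snocEquiv_tmul (k : Fin r → Fin n) (j : Fin n) :
    snocEquiv n r (ξ ℂ k ⊗ₜ Pi.single j 1) = ξ ℂ (Fin.snoc k j) := by
  have h1 : (PiTensorProduct.subsingletonEquiv (R := ℂ) (s := fun _ : Fin 1 => (Fin n → ℂ)) 0).symm
      (Pi.single j 1) = PiTensorProduct.tprod ℂ fun _ => Pi.single j 1 := by
    rw [LinearEquiv.symm_apply_eq, PiTensorProduct.subsingletonEquiv_apply_tprod]
  rw [snocEquiv, LinearEquiv.trans_apply, TensorProduct.congr_tmul, LinearEquiv.refl_apply, h1,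
    ξ_apply, ξ_apply, ← TensorPower.gMul_def, TensorPower.tprod_mul_tprod]
  congr 1
  funext p
  refine Fin.lastCases ?_ (fun p => ?_) p
  · rw [Fin.snoc_last]
    exact Fin.append_right _ _ 0
  · rw [Fin.snoc_castSucc]
    exact Fin.append_left _ _ p

theorem rhoV_gen (g : UGen n) :
    rhoV (U0.mk (FreeAlgebra.ι ℂ g)) = Matrix.toLin' (rhoGen g) := by
  have h : RingQuot.liftAlgHom ℂ ⟨FreeAlgebra.lift ℂ rhoGen, lift_rhoGen_rel⟩
      (RingQuot.mkAlgHom ℂ (URel (n := n)) (FreeAlgebra.ι ℂ g)) = rhoGen g :=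
    (RingQuot.liftAlgHom_mkAlgHom_apply ..).trans (FreeAlgebra.lift_ι_apply _ _)
  exact congrArg Matrix.toLin' h

theorem comul_gen (g : UGen n) : comul (U0.mk (FreeAlgebra.ι ℂ g)) = comulGen g :=
  (RingQuot.liftAlgHom_mkAlgHom_apply ..).trans (FreeAlgebra.lift_ι_apply _ _)

theorem counit_gen (g : UGen n) : counit (U0.mk (FreeAlgebra.ι ℂ g)) = counitGen g :=
  (RingQuot.liftAlgHom_mkAlgHom_apply ..).trans (FreeAlgebra.lift_ι_apply _ _)

theorem single_mulVec_single (a b j : Fin n) :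
    (Matrix.single a b (1 : ℂ)).mulVec (Pi.single j 1) =
      if j = b then (Pi.single a 1 : Fin n → ℂ) else 0 := by
  rw [Matrix.mulVec_single_one]
  funext i
  split_ifs with h
  · simp [Matrix.col_apply, Matrix.single_apply, Pi.single_apply, h, eq_comm]
  · simp [Matrix.col_apply, Ne.symm h]

theorem rhoV_e (i : Adj n) (j : Fin n) :
    rhoV (U0.e i) (Pi.single j 1) = if j = i.hi then (Pi.single i.lo 1 : Fin n → ℂ) else 0 := by
  rw [U0.e, fe, rhoV_gen, Matrix.toLin'_apply, rhoGen, single_mulVec_single]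

theorem rhoV_f (i : Adj n) (j : Fin n) :
    rhoV (U0.f i) (Pi.single j 1) = if j = i.lo then (Pi.single i.hi 1 : Fin n → ℂ) else 0 := by
  rw [U0.f, ff, rhoV_gen, Matrix.toLin'_apply, rhoGen, single_mulVec_single]

theorem rhoV_k (i j : Fin n) :
    rhoV (U0.k i) (Pi.single j 1) = if j ≠ i then (Pi.single j 1 : Fin n → ℂ) else 0 := by
  rw [U0.k, fk, rhoV_gen, Matrix.toLin'_apply, rhoGen, Matrix.sum_mulVec]
  simp only [single_mulVec_single]
  rw [Finset.sum_ite_eq]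
  simp

theorem rhoT_zero (u : U0 n) (v : TSpace ℂ n 0) : rhoT n 0 u v = counit u • v := rfl

/-- The value of `rhoT` on a tensor product in terms of the comultiplication. -/
theorem rhoT_succ (u : U0 n) (v : TSpace ℂ n r) (x : Fin n → ℂ) :
    rhoT n (r + 1) u (snocEquiv n r (v ⊗ₜ x)) = snocEquiv n r
      (Module.endTensorEndAlgHom (R := ℂ) (S := ℂ) (A := ℂ)
        (Algebra.TensorProduct.map (rhoT n r) rhoV (comul u)) (v ⊗ₜ x)) := by
  have h : rhoT n (r + 1) u = (snocEquiv n r).conjAlgEquiv ℂ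
      (Module.endTensorEndAlgHom (R := ℂ) (S := ℂ) (A := ℂ)
        (Algebra.TensorProduct.map (rhoT n r) rhoV (comul u))) := rfl
  rw [h, LinearEquiv.conjAlgEquiv_apply, LinearMap.comp_apply, LinearMap.comp_apply,
    LinearEquiv.coe_coe, LinearEquiv.coe_coe, LinearEquiv.symm_apply_apply]

theorem rhoT_k (i : Fin n) (k : Fin r → Fin n) :
    rhoT n r (U0.k i) (ξ ℂ k) = if ∀ p, k p ≠ i then ξ ℂ k else 0 := by
  induction r with
  | zero =>
    rw [rhoT_zero, U0.k, fk, counit_gen, counitGen, one_smul, if_pos fun p => p.elim0]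
  | succ r ih =>
    obtain ⟨k, j, rfl⟩ : ∃ k' j, k = Fin.snoc k' j := ⟨_, _, (Fin.snoc_init_self k).symm⟩
    rw [← snocEquiv_tmul, rhoT_succ, U0.k, fk, comul_gen, comulGen,
      Algebra.TensorProduct.map_tmul, Module.endTensorEndAlgHom_apply,
      TensorProduct.AlgebraTensorModule.map_tmul, ih, rhoV_k, snocEquiv_tmul]
    simp only [Fin.forall_fin_succ', Fin.snoc_castSucc, Fin.snoc_last]
    by_cases h1 : ∀ p, k p ≠ i <;> by_cases h2 : j ≠ i
    · rw [if_pos h1, if_pos h2, if_pos ⟨h1, h2⟩, snocEquiv_tmul]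
    · rw [if_neg h2, if_neg (show ¬ (_ ∧ _) from fun h => h2 h.2), TensorProduct.tmul_zero, map_zero]
    · rw [if_neg h1, if_neg (show ¬ (_ ∧ _) from fun h => h1 h.1), TensorProduct.zero_tmul, map_zero]
    · rw [if_neg h2, if_neg (show ¬ (_ ∧ _) from fun h => h2 h.2), TensorProduct.tmul_zero, map_zero]

/-- The iterated comultiplication of `e_i` is the sum of the tensors `1 ⊗ ⋯ ⊗ 1 ⊗ e_i ⊗ k_i ⊗ ⋯ ⊗
k_i`. The factors `k_i` kill a word with a letter `i` to the right of the changed position. -/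
theorem rhoT_e (i : Adj n) (k : Fin r → Fin n) :
    rhoT n r (U0.e i) (ξ ℂ k) = ∑ p, if k p = i.hi ∧ ∀ p', p < p' → k p' ≠ i.lo then
      ξ ℂ (Function.update k p i.lo) else 0 := by
  induction r with
  | zero =>
    rw [rhoT_zero, U0.e, fe, counit_gen, counitGen, zero_smul]
    rfl
  | succ r ih =>
    obtain ⟨k, j, rfl⟩ : ∃ k' j, k = Fin.snoc k' j := ⟨_, _, (Fin.snoc_init_self k).symm⟩
    rw [← snocEquiv_tmul, rhoT_succ, U0.e, fe, comul_gen, comulGen, map_add, map_add,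
      Algebra.TensorProduct.map_tmul, Algebra.TensorProduct.map_tmul, LinearMap.add_apply,
      Module.endTensorEndAlgHom_apply, Module.endTensorEndAlgHom_apply,
      TensorProduct.AlgebraTensorModule.map_tmul, TensorProduct.AlgebraTensorModule.map_tmul,
      ih, rhoV_k, rhoV_e, map_one, Module.End.one_apply, Fin.sum_univ_castSucc, map_add,
      add_comm (snocEquiv n r _), TensorProduct.sum_tmul, map_sum]
    congr 1
    · refine Finset.sum_congr rfl fun p _ => ?_
      simp only [Fin.forall_fin_succ', Fin.snoc_castSucc, Fin.snoc_last,
        Fin.castSucc_lt_castSucc_iff, Fin.castSucc_lt_last, forall_const]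
      by_cases h1 : k p = i.hi ∧ ∀ p', p < p' → k p' ≠ i.lo <;> by_cases h2 : j ≠ i.lo
      · rw [if_pos h1, if_pos h2, if_pos ⟨h1.1, h1.2, h2⟩, snocEquiv_tmul, Fin.snoc_update]
      · rw [if_neg h2, if_neg (show ¬ (_ ∧ _ ∧ _) from fun h => h2 h.2.2), TensorProduct.tmul_zero, map_zero]
      · rw [if_neg h1, if_neg (show ¬ (_ ∧ _ ∧ _) from fun h => h1 ⟨h.1, h.2.1⟩), TensorProduct.zero_tmul, map_zero]
      · rw [if_neg h2, if_neg (show ¬ (_ ∧ _ ∧ _) from fun h => h2 h.2.2), TensorProduct.tmul_zero, map_zero]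
    · have h0 : ∀ p', Fin.last r < p' → (Fin.snoc k j : Fin (r + 1) → Fin n) p' ≠ i.lo :=
        fun p' h => absurd h (not_lt.2 (Fin.le_last p'))
      simp only [and_iff_left h0, Fin.snoc_last, Fin.update_snoc_last]
      split_ifs
      · rw [snocEquiv_tmul]
      · rw [TensorProduct.tmul_zero, map_zero]

/-- Here the summands are `k_{i+1} ⊗ ⋯ ⊗ k_{i+1} ⊗ f_i ⊗ 1 ⊗ ⋯ ⊗ 1`, so the obstruction is a letter
`i+1` to the left. -/
theorem rhoT_f (i : Adj n) (k : Fin r → Fin n) :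
    rhoT n r (U0.f i) (ξ ℂ k) = ∑ p, if k p = i.lo ∧ ∀ p', p' < p → k p' ≠ i.hi then
      ξ ℂ (Function.update k p i.hi) else 0 := by
  induction r with
  | zero =>
    rw [rhoT_zero, U0.f, ff, counit_gen, counitGen, zero_smul]
    rfl
  | succ r ih =>
    obtain ⟨k, j, rfl⟩ : ∃ k' j, k = Fin.snoc k' j := ⟨_, _, (Fin.snoc_init_self k).symm⟩
    rw [← snocEquiv_tmul, rhoT_succ, U0.f, ff, comul_gen, comulGen, map_add, map_add,
      Algebra.TensorProduct.map_tmul, Algebra.TensorProduct.map_tmul, LinearMap.add_apply,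
      Module.endTensorEndAlgHom_apply, Module.endTensorEndAlgHom_apply,
      TensorProduct.AlgebraTensorModule.map_tmul, TensorProduct.AlgebraTensorModule.map_tmul,
      ih, rhoT_k, rhoV_f, map_one, Module.End.one_apply, Fin.sum_univ_castSucc, map_add,
      add_comm (snocEquiv n r _), TensorProduct.sum_tmul, map_sum]
    congr 1
    · refine Finset.sum_congr rfl fun p _ => ?_
      simp only [Fin.forall_fin_succ', Fin.snoc_castSucc, Fin.snoc_last,
        Fin.castSucc_lt_castSucc_iff, (Fin.castSucc_lt_last p).not_gt, false_implies, and_true]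
      split_ifs
      · rw [snocEquiv_tmul, Fin.snoc_update]
      · rw [TensorProduct.zero_tmul, map_zero]
    · simp only [Fin.forall_fin_succ', Fin.snoc_castSucc, Fin.snoc_last, Fin.update_snoc_last,
        Fin.castSucc_lt_last, forall_const, lt_irrefl, false_implies, and_true]
      by_cases h1 : ∀ p, k p ≠ i.hi <;> by_cases h2 : j = i.lo
      · rw [if_pos h1, if_pos h2, if_pos ⟨h2, h1⟩, snocEquiv_tmul]
      · rw [if_neg h2, if_neg (show ¬ (_ ∧ _) from fun h => h2 h.1), TensorProduct.tmul_zero, map_zero]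
      · rw [if_neg h1, if_neg (show ¬ (_ ∧ _) from fun h => h1 h.2), TensorProduct.zero_tmul, map_zero]
      · rw [if_neg h2, if_neg (show ¬ (_ ∧ _) from fun h => h2 h.1), TensorProduct.tmul_zero, map_zero]

end Action

/-! ### The actions of the degenerate quantum group and of the `0`-Hecke algebra commute -/

section Commute

variable {n r : ℕ}

theorem actT_zero_ξ (j : Adj r) (k : Fin r → Fin n) : actT ℂ 0 j (ξ ℂ k) =
    if k j.lo < k j.hi then ξ ℂ (k ∘ simpleSwap j)
    else if k j.lo = k j.hi then 0 else - ξ ℂ k := by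
  have h : (-1 : ℂ) • ξ ℂ k = - ξ ℂ k := neg_one_smul ℂ (ξ ℂ k)
  rw [actT_ξ, zero_smul, zero_smul, zero_add, zero_sub, h]

theorem update_comp_simpleSwap (k : Fin r → Fin n) (j : Adj r) (p : Fin r) (y : Fin n) :
    Function.update k p y ∘ simpleSwap j =
      Function.update (k ∘ simpleSwap j) (simpleSwap j p) y := by
  rw [Function.update_comp_equiv]
  congr 1

/-- A criterion for an operator that changes single letters of a word to commute with the right
action of a generator of the `0`-Hecke algebra. -/
theorem commute_actT_of_pair {g : Module.End ℂ (TSpace ℂ n r)}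
    {C : (Fin r → Fin n) → Fin r → Prop} [∀ k p, Decidable (C k p)] {y : Fin n}
    (hg : ∀ k, g (ξ ℂ k) = ∑ p, if C k p then ξ ℂ (Function.update k p y) else 0) (j : Adj r)
    (hC : ∀ k p, p ≠ j.lo → p ≠ j.hi → (C (k ∘ simpleSwap j) p ↔ C k p))
    (hpair : ∀ k P, (P = fun k => (if C k j.lo then ξ ℂ (Function.update k j.lo y) else 0) +
        if C k j.hi then ξ ℂ (Function.update k j.hi y) else 0) →
      actT ℂ 0 j (P k) = if k j.lo < k j.hi then P (k ∘ simpleSwap j)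
        else if k j.lo = k j.hi then 0 else - P k)
    (v : TSpace ℂ n r) : g (actT ℂ 0 j v) = actT ℂ 0 j (g v) := by
  refine DFunLike.congr_fun (f := g.comp (actT ℂ 0 j)) (g := (actT ℂ 0 j).comp g)
    ((ξ ℂ).ext fun k => ?_) v
  let P : (Fin r → Fin n) → TSpace ℂ n r := fun k =>
    (if C k j.lo then ξ ℂ (Function.update k j.lo y) else 0) +
      if C k j.hi then ξ ℂ (Function.update k j.hi y) else 0
  -- The terms at the positions that `T_j` does not touch. A change there leaves the two compared
  -- letters alone, so these terms transform one by one in the same way as `ξ k`.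
  let Q : (Fin r → Fin n) → TSpace ℂ n r := fun k =>
    ∑ p ∈ (Finset.univ.erase j.lo).erase j.hi,
      if C k p then ξ ℂ (Function.update k p y) else 0
  have hg' : ∀ k, g (ξ ℂ k) = P k + Q k := by
    intro k
    rw [hg, ← Finset.add_sum_erase _ _ (Finset.mem_univ j.lo),
      ← Finset.add_sum_erase (Finset.univ.erase j.lo) _
        (Finset.mem_erase.2 ⟨j.lo_lt_hi.ne', Finset.mem_univ j.hi⟩), add_assoc]
  have hQ : actT ℂ 0 j (Q k) = if k j.lo < k j.hi then Q (k ∘ simpleSwap j)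
        else if k j.lo = k j.hi then 0 else - Q k := by
    have key : ∀ p ∈ (Finset.univ.erase j.lo).erase j.hi,
        actT ℂ 0 j (if C k p then ξ ℂ (Function.update k p y) else 0) =
          if k j.lo < k j.hi then (if C (k ∘ simpleSwap j) p then
            ξ ℂ (Function.update (k ∘ simpleSwap j) p y) else 0)
          else if k j.lo = k j.hi then 0 else
            - (if C k p then ξ ℂ (Function.update k p y) else 0) := by
      intro p hp
      simp only [Finset.mem_erase, Finset.mem_univ, and_true] at hp
      simp only [hC k p hp.2 hp.1]
      by_cases h : C k p
      · simp only [if_pos h]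
        rw [actT_zero_ξ, Function.update_of_ne hp.2.symm, Function.update_of_ne hp.1.symm,
          update_comp_simpleSwap, simpleSwap_of_ne hp.2 hp.1]
      · simp [if_neg h]
    simp only [Q, map_sum]
    rw [Finset.sum_congr rfl key]
    split_ifs
    · rfl
    · exact Finset.sum_const_zero
    · rw [Finset.sum_neg_distrib]
  rw [LinearMap.comp_apply, LinearMap.comp_apply, hg', map_add, hpair k P rfl, hQ, actT_zero_ξ]
  split_ifs
  · rw [hg']
  · rw [map_zero, add_zero]
  · rw [map_neg, hg', neg_add]

theorem actT_pair_e (i : Adj n) (j : Adj r) (k : Fin r → Fin n) :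
    actT ℂ 0 j ((if k j.lo = i.hi ∧ k j.hi ≠ i.lo then ξ ℂ (Function.update k j.lo i.lo) else 0)
        + if k j.hi = i.hi then ξ ℂ (Function.update k j.hi i.lo) else 0) =
      if k j.lo < k j.hi then
        (if k j.hi = i.hi ∧ k j.lo ≠ i.lo then
          ξ ℂ (Function.update (k ∘ simpleSwap j) j.lo i.lo) else 0)
        + if k j.lo = i.hi then ξ ℂ (Function.update (k ∘ simpleSwap j) j.hi i.lo) else 0
      else if k j.lo = k j.hi then 0
      else -((if k j.lo = i.hi ∧ k j.hi ≠ i.lo then ξ ℂ (Function.update k j.lo i.lo) else 0)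
        + if k j.hi = i.hi then ξ ℂ (Function.update k j.hi i.lo) else 0) := by
  -- No letter lies strictly between the two, so replacing one by the other changes a strict
  -- comparison only against these two letters. When both letters of `k` equal `i.hi`, the two terms
  -- cancel after `T_j` acts.
  have hlh : i.hi.1 = i.lo.1 + 1 := rfl
  have hne := j.lo_lt_hi.ne
  have ulo := update_comp_simpleSwap k j j.lo i.lo
  have uhi := update_comp_simpleSwap k j j.hi i.lo
  rw [simpleSwap_lo] at ulo
  rw [simpleSwap_hi] at uhi
  have a1 := actT_zero_ξ j (Function.update k j.lo i.lo)
  have a2 := actT_zero_ξ j (Function.update k j.hi i.lo)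
  rw [Function.update_self, Function.update_of_ne hne.symm, ulo] at a1
  rw [Function.update_self, Function.update_of_ne hne, uhi] at a2
  rcases lt_trichotomy (k j.lo) (k j.hi) with h | h | h
  · simp only [if_pos h, map_add, apply_ite (actT ℂ 0 j), map_zero, a1, a2]
    split_ifs <;> first | (exfalso; omega) | simp
  · have e := comp_simpleSwap_eq_self h
    simp only [if_neg h.not_lt, if_pos h, map_add, apply_ite (actT ℂ 0 j), map_zero, a1, a2, e]
    split_ifs <;> first | (exfalso; omega) | simp
  · simp only [if_neg h.not_gt, if_neg h.ne', map_add, apply_ite (actT ℂ 0 j), map_zero, a1, a2]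
    split_ifs <;> first | (exfalso; omega) | simp

theorem actT_pair_f (i : Adj n) (j : Adj r) (k : Fin r → Fin n) :
    actT ℂ 0 j ((if k j.lo = i.lo then ξ ℂ (Function.update k j.lo i.hi) else 0)
        + if k j.hi = i.lo ∧ k j.lo ≠ i.hi then ξ ℂ (Function.update k j.hi i.hi) else 0) =
      if k j.lo < k j.hi then
        (if k j.hi = i.lo then ξ ℂ (Function.update (k ∘ simpleSwap j) j.lo i.hi) else 0)
        + if k j.lo = i.lo ∧ k j.hi ≠ i.hi then
          ξ ℂ (Function.update (k ∘ simpleSwap j) j.hi i.hi) else 0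
      else if k j.lo = k j.hi then 0
      else -((if k j.lo = i.lo then ξ ℂ (Function.update k j.lo i.hi) else 0)
        + if k j.hi = i.lo ∧ k j.lo ≠ i.hi then ξ ℂ (Function.update k j.hi i.hi) else 0) := by
  have hlh : i.hi.1 = i.lo.1 + 1 := rfl
  have hne := j.lo_lt_hi.ne
  have ulo := update_comp_simpleSwap k j j.lo i.hi
  have uhi := update_comp_simpleSwap k j j.hi i.hi
  rw [simpleSwap_lo] at ulo
  rw [simpleSwap_hi] at uhi
  have a1 := actT_zero_ξ j (Function.update k j.lo i.hi)
  have a2 := actT_zero_ξ j (Function.update k j.hi i.hi)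
  rw [Function.update_self, Function.update_of_ne hne.symm, ulo] at a1
  rw [Function.update_self, Function.update_of_ne hne, uhi] at a2
  rcases lt_trichotomy (k j.lo) (k j.hi) with h | h | h
  · simp only [if_pos h, map_add, apply_ite (actT ℂ 0 j), map_zero, a1, a2]
    split_ifs <;> first | (exfalso; omega) | simp
  · have e := comp_simpleSwap_eq_self h
    simp only [if_neg h.not_lt, if_pos h, map_add, apply_ite (actT ℂ 0 j), map_zero, a1, a2, e]
    split_ifs <;> first | (exfalso; omega) | simp
  · simp only [if_neg h.not_gt, if_neg h.ne', map_add, apply_ite (actT ℂ 0 j), map_zero, a1, a2]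
    split_ifs <;> first | (exfalso; omega) | simp

theorem commute_rhoT_e (i : Adj n) (j : Adj r) (v : TSpace ℂ n r) :
    rhoT n r (U0.e i) (actT ℂ 0 j v) = actT ℂ 0 j (rhoT n r (U0.e i) v) := by
  have hsw : ∀ p p' : Fin r, p ≠ j.lo → p ≠ j.hi → (p < p' ↔ p < simpleSwap j p') := by
    intro p p' h1 h2
    simp only [simpleSwap, Equiv.swap_apply_def]
    simp only [Adj.lo, Adj.hi, Fin.lt_def, Fin.ext_iff, ne_eq] at *
    split_ifs <;> simp_all <;> omega
  refine commute_actT_of_pair (rhoT_e i) j (fun k p h1 h2 => ?_) (fun k P hP => ?_) v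
  · simp only [Function.comp, simpleSwap_of_ne h1 h2]
    refine and_congr_right fun _ => ⟨fun h p' hp' => ?_, fun h p' hp' => ?_⟩
    · have := h (simpleSwap j p') ((hsw _ _ h1 h2).1 hp')
      rwa [simpleSwap_simpleSwap] at this
    · exact h _ ((hsw _ _ h1 h2).1 hp')
  -- The proviso at `j.lo` is the one at `j.hi` plus a condition on the letter at `j.hi`. The common
  -- part is unaffected by the swap. If it fails, both terms vanish, and otherwise the two-letter
  -- identity applies.
  · have hlo : ∀ k : Fin r → Fin n, (∀ p', j.lo < p' → k p' ≠ i.lo) ↔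
        k j.hi ≠ i.lo ∧ ∀ p', j.hi < p' → k p' ≠ i.lo := by
      intro k
      refine ⟨fun h => ⟨h _ j.lo_lt_hi, fun p' hp' => h _ (j.lo_lt_hi.trans hp')⟩, ?_⟩
      rintro ⟨h1, h2⟩ p' hp'
      rcases eq_or_ne p' j.hi with rfl | h3
      · exact h1
      · refine h2 p' ?_
        simp only [Adj.lo, Adj.hi, Fin.lt_def, Fin.ext_iff, ne_eq] at *
        omega
    have hN : (∀ p', j.hi < p' → (k ∘ simpleSwap j) p' ≠ i.lo) ↔
        ∀ p', j.hi < p' → k p' ≠ i.lo := by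
      refine forall_congr' fun p' => imp_congr_right fun hp' => ?_
      rw [Function.comp, simpleSwap_of_ne (j.lo_lt_hi.trans hp').ne' hp'.ne']
    simp only [hP, hlo, hN, ← and_assoc]
    by_cases N : ∀ p', j.hi < p' → k p' ≠ i.lo
    · simp only [and_iff_left N, Function.comp_apply, simpleSwap_lo, simpleSwap_hi]
      exact actT_pair_e i j k
    · have hF : ∀ Q : Prop, ¬ (Q ∧ ∀ p', j.hi < p' → k p' ≠ i.lo) := fun _ h => N h.2
      simp only [if_neg (hF _), add_zero, map_zero, neg_zero, ite_self]

theorem commute_rhoT_f (i : Adj n) (j : Adj r) (v : TSpace ℂ n r) :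
    rhoT n r (U0.f i) (actT ℂ 0 j v) = actT ℂ 0 j (rhoT n r (U0.f i) v) := by
  have hsw : ∀ p p' : Fin r, p ≠ j.lo → p ≠ j.hi → (p' < p ↔ simpleSwap j p' < p) := by
    intro p p' h1 h2
    simp only [simpleSwap, Equiv.swap_apply_def]
    simp only [Adj.lo, Adj.hi, Fin.lt_def, Fin.ext_iff, ne_eq] at *
    split_ifs <;> simp_all <;> omega
  refine commute_actT_of_pair (rhoT_f i) j (fun k p h1 h2 => ?_) (fun k P hP => ?_) v
  · simp only [Function.comp, simpleSwap_of_ne h1 h2]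
    refine and_congr_right fun _ => ⟨fun h p' hp' => ?_, fun h p' hp' => ?_⟩
    · have := h (simpleSwap j p') ((hsw _ _ h1 h2).1 hp')
      rwa [simpleSwap_simpleSwap] at this
    · exact h _ ((hsw _ _ h1 h2).1 hp')
  · have hhi : ∀ k : Fin r → Fin n, (∀ p', p' < j.hi → k p' ≠ i.hi) ↔
        k j.lo ≠ i.hi ∧ ∀ p', p' < j.lo → k p' ≠ i.hi := by
      intro k
      refine ⟨fun h => ⟨h _ j.lo_lt_hi, fun p' hp' => h _ (hp'.trans j.lo_lt_hi)⟩, ?_⟩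
      rintro ⟨h1, h2⟩ p' hp'
      rcases eq_or_ne p' j.lo with rfl | h3
      · exact h1
      · refine h2 p' ?_
        simp only [Adj.lo, Adj.hi, Fin.lt_def, Fin.ext_iff, ne_eq] at *
        omega
    have hN : (∀ p', p' < j.lo → (k ∘ simpleSwap j) p' ≠ i.hi) ↔
        ∀ p', p' < j.lo → k p' ≠ i.hi := by
      refine forall_congr' fun p' => imp_congr_right fun hp' => ?_
      rw [Function.comp, simpleSwap_of_ne hp'.ne (hp'.trans j.lo_lt_hi).ne]
    simp only [hP, hhi, hN, ← and_assoc]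
    by_cases N : ∀ p', p' < j.lo → k p' ≠ i.hi
    · simp only [and_iff_left N, Function.comp_apply, simpleSwap_lo, simpleSwap_hi]
      exact actT_pair_f i j k
    · have hF : ∀ Q : Prop, ¬ (Q ∧ ∀ p', p' < j.lo → k p' ≠ i.hi) := fun _ h => N h.2
      simp only [if_neg (hF _), add_zero, map_zero, neg_zero, ite_self]

theorem commute_rhoT_k (i : Fin n) (j : Adj r) (v : TSpace ℂ n r) :
    rhoT n r (U0.k i) (actT ℂ 0 j v) = actT ℂ 0 j (rhoT n r (U0.k i) v) := by
  refine DFunLike.congr_fun (f := (rhoT n r (U0.k i)).comp (actT ℂ 0 j))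
    (g := (actT ℂ 0 j).comp (rhoT n r (U0.k i))) ((ξ ℂ).ext fun k => ?_) v
  have h : (∀ p, (k ∘ simpleSwap j) p ≠ i) ↔ ∀ p, k p ≠ i :=
    ⟨fun h p => by simpa [simpleSwap_simpleSwap] using h (simpleSwap j p), fun h p => h _⟩
  rw [LinearMap.comp_apply, LinearMap.comp_apply, rhoT_k, actT_zero_ξ]
  by_cases hk : ∀ p, k p ≠ i
  · rw [if_pos hk, actT_zero_ξ]
    split_ifs
    · rw [rhoT_k, if_pos (h.2 hk)]
    · rw [map_zero]
    · rw [map_neg, rhoT_k, if_pos hk]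
  · rw [if_neg hk, map_zero]
    split_ifs
    · rw [rhoT_k, if_neg (fun h' => hk (h.1 h'))]
    · rw [map_zero]
    · rw [map_neg, rhoT_k, if_neg hk, neg_zero]

theorem U0.induction {P : U0 n → Prop} (algebraMap : ∀ c : ℂ, P (algebraMap ℂ _ c))
    (e : ∀ i, P (U0.e i)) (f : ∀ i, P (U0.f i)) (k : ∀ i, P (U0.k i))
    (mul : ∀ x y, P x → P y → P (x * y)) (add : ∀ x y, P x → P y → P (x + y)) (x : U0 n) :
    P x := by
  obtain ⟨y, rfl⟩ := RingQuot.mkAlgHom_surjective ℂ (URel (n := n)) x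
  induction y using FreeAlgebra.induction with
  | grade0 c =>
    rw [AlgHom.commutes]
    exact algebraMap c
  | grade1 g =>
    cases g with
    | e i => exact e i
    | f i => exact f i
    | k i => exact k i
  | mul a b ha hb => rw [map_mul]; exact mul _ _ ha hb
  | add a b ha hb => rw [map_add]; exact add _ _ ha hb

theorem commute_rhoT (u : U0 n) (j : Adj r) (v : TSpace ℂ n r) :
    rhoT n r u (actT ℂ 0 j v) = actT ℂ 0 j (rhoT n r u v) := by
  induction u using U0.induction generalizing v with
  | algebraMap c =>
    rw [AlgHom.commutes, Module.algebraMap_end_apply, Module.algebraMap_end_apply, map_smul]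
  | e i => exact commute_rhoT_e i j v
  | f i => exact commute_rhoT_f i j v
  | k i => exact commute_rhoT_k i j v
  | mul x y hx hy =>
    rw [map_mul, Module.End.mul_apply, Module.End.mul_apply, hy, hx]
  | add x y hx hy =>
    rw [map_add, LinearMap.add_apply, LinearMap.add_apply, map_add, hx, hy]

/-- The action of an element of `U_0(gl_n)` as an endomorphism of the right module of the `0`-Hecke
algebra. -/
def rhoH (u : U0 n) : TSpace ℂ n r →ₗ[(Hecke ℂ 0 r)ᵐᵒᵖ] TSpace ℂ n r where
  toFun := rhoT n r u
  map_add' := map_add _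
  map_smul' := map_op_smul (rhoT n r u) fun i v => by
    rw [op_T_smul, op_T_smul, commute_rhoT]

/-- The homomorphism from `U_0(gl_n)` to the endomorphism algebra of the permutation module. -/
def psiEnd (n r : ℕ) : U0 n →ₐ[ℂ] Schur ℂ 0 n r :=
  AlgHom.ofLinearMap
    { toFun := fun u => (permEquiv ℂ 0).symm.toLinearMap.comp
        ((rhoH u).comp (permEquiv ℂ 0).toLinearMap)
      map_add' := fun u v => by
        refine LinearMap.ext fun m => (permEquiv ℂ 0).injective ?_
        simp [rhoH]
      map_smul' := fun c u => by
        refine LinearMap.ext fun m => (permEquiv ℂ 0).injective ?_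
        have h : (permEquiv ℂ 0).toLinearMap (c • (permEquiv ℂ 0).symm (rhoT n r u
            (permEquiv ℂ 0 m))) = c • rhoT n r u (permEquiv ℂ 0 m) := by
          rw [LinearMap.map_smul_of_tower, LinearEquiv.coe_coe, LinearEquiv.apply_symm_apply]
        refine Eq.trans ?_ h.symm
        simp [rhoH] }
    (by
      refine LinearMap.ext fun m => (permEquiv ℂ 0).injective ?_
      simp [rhoH])
    fun u v => by
      refine LinearMap.ext fun m => (permEquiv ℂ 0).injective ?_
      simp [rhoH]

theorem permEquiv_psiEnd (u : U0 n) (m : PermMod ℂ 0 n r) :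
    permEquiv ℂ 0 (psiEnd n r u m) = rhoT n r u (permEquiv ℂ 0 m) :=
  (permEquiv ℂ 0).apply_symm_apply _

end Commute

/-! ### The images of the generators -/

section Images

variable {n r : ℕ}

theorem wmat_self (m : Fin r → Fin n) : wmat m m = Matrix.diagonal (wt m).1 := by
  funext i j
  rw [Matrix.diagonal_apply]
  split_ifs with h
  · subst h
    simp [wmat, wt]
  · simp only [wmat, Finset.card_eq_zero, Finset.filter_eq_empty_iff]
    rintro p - ⟨rfl, rfl⟩
    exact h rfl

/-- Stated additively to avoid truncated subtraction of natural numbers. -/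
theorem wmat_update (m : Fin r → Fin n) (p : Fin r) (a : Fin n) :
    wmat (Function.update m p a) m + Matrix.single (m p) (m p) 1 =
      wmat m m + Matrix.single a (m p) 1 := by
  funext i j
  simp only [Matrix.add_apply, wmat, Finset.card_filter, Matrix.single_apply]
  rw [← Finset.add_sum_erase _ _ (Finset.mem_univ p), ← Finset.add_sum_erase _
    (fun x => if m x = i ∧ m x = j then 1 else 0) (Finset.mem_univ p), Function.update_self]
  have : ∀ x ∈ Finset.univ.erase p, (if Function.update m p a x = i ∧ m x = j then 1 else 0) =
      if m x = i ∧ m x = j then 1 else 0 := fun x hx => by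
    rw [Function.update_of_ne (Finset.ne_of_mem_erase hx)]
  rw [Finset.sum_congr rfl this]
  omega

theorem single_le_diagonal {l : WComp n r} {b : Fin n} (h : 0 < l.1 b) (i j : Fin n) :
    (Matrix.single b b 1 : Matrix (Fin n) (Fin n) ℕ) i j ≤ Matrix.diagonal l.1 i j := by
  rw [Matrix.single_apply]
  split_ifs with hij
  · obtain ⟨rfl, rfl⟩ := hij
    rw [Matrix.diagonal_apply_eq]
    exact h
  · exact Nat.zero_le _

theorem moved_add (l : WComp n r) (a b : Fin n) (h : 0 < l.1 b) :
    (moved l a b h).1 + Matrix.single b b 1 = Matrix.diagonal l.1 + Matrix.single a b 1 := by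
  funext i j
  have := single_le_diagonal h i j
  simp only [moved, Matrix.add_apply, Matrix.sub_apply]
  omega

theorem co_moved (l : WComp n r) (a b : Fin n) (h : 0 < l.1 b) : co (moved l a b h) = l := by
  apply Subtype.ext
  funext j
  have h1 := congrArg (fun A : Matrix (Fin n) (Fin n) ℕ => ∑ i, A i j) (moved_add l a b h)
  simp only [Matrix.add_apply, Finset.sum_add_distrib] at h1
  have h2 : ∀ c : Fin n, ∑ i, (Matrix.single c b 1 : Matrix (Fin n) (Fin n) ℕ) i j =
      if b = j then 1 else 0 := by
    intro c
    simp [Matrix.single_apply, ite_and]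
  rw [h2, h2, add_left_inj] at h1
  refine h1.trans ?_
  simp [Matrix.diagonal_apply]

theorem exists_iword_eq {l : WComp n r} {b : Fin n} : (∃ p, iword l p = b) ↔ 0 < l.1 b := by
  have h : l.1 b = (Finset.univ.filter fun p => iword l p = b).card := by
    conv_lhs => rw [← wt_iword l]
    rfl
  rw [h, Finset.card_pos]
  simp [Finset.Nonempty]

/-- Off the diagonal the matrix has the single entry `1` at `(a, b)`. So `k` and `iword l` disagree
at exactly one position, where `b` has become `a`. -/
theorem nmat_eq_moved_iff (l : WComp n r) {a b : Fin n} (hab : a ≠ b) (h : 0 < l.1 b)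
    (k : Fin r → Fin n) : nmat k (iword l) = moved l a b h ↔
      ∃ p, iword l p = b ∧ Function.update (iword l) p a = k := by
  constructor
  · intro hk
    have h1 : ∀ i j, i ≠ j → wmat k (iword l) i j = if a = i ∧ b = j then 1 else 0 := by
      intro i j hij
      have e1 := congrFun (congrFun (moved_add l a b h) i) j
      rw [← hk] at e1
      simp only [Matrix.add_apply, Matrix.diagonal_apply_ne _ hij, Matrix.single_apply] at e1
      rw [if_neg fun h' => hij (h'.1.symm.trans h'.2)] at e1
      simpa [nmat] using e1
    have h2 := h1 a b hab
    rw [if_pos ⟨rfl, rfl⟩, wmat, Finset.card_eq_one] at h2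
    obtain ⟨p, hp⟩ := h2
    have h3 : k p = a ∧ iword l p = b := by
      have := Finset.mem_singleton_self p
      rw [← hp] at this
      exact (Finset.mem_filter.1 this).2
    refine ⟨p, h3.2, ?_⟩
    funext x
    rcases eq_or_ne x p with rfl | hx
    · rw [Function.update_self, h3.1]
    · rw [Function.update_of_ne hx]
      by_contra hne
      have h4 : 0 < wmat k (iword l) (k x) (iword l x) :=
        Finset.card_pos.2 ⟨x, by simp⟩
      rw [h1 _ _ (Ne.symm hne)] at h4
      split_ifs at h4 with h5
      · apply hx
        rw [← Finset.mem_singleton, ← hp]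
        simp [h5.1, h5.2]
      · exact absurd h4 (lt_irrefl 0)
  · rintro ⟨p, hp, rfl⟩
    apply Subtype.ext
    have h1 := wmat_update (iword l) p a
    rw [hp, wmat_self, wt_iword, ← moved_add l a b h] at h1
    exact add_right_cancel h1

theorem orb_moved (l : WComp n r) {a b : Fin n} (hab : a ≠ b) (h : 0 < l.1 b) :
    orb ℂ (moved l a b h) =
      ∑ p, if iword l p = b then ξ ℂ (Function.update (iword l) p a) else 0 := by
  rw [← Finset.sum_filter, orb]
  symm
  refine Finset.sum_bij (fun p _ => Function.update (iword l) p a) ?_ ?_ ?_ fun _ _ => rfl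
  · intro p hp
    rw [Finset.mem_filter, co_moved, nmat_eq_moved_iff l hab]
    exact ⟨Finset.mem_univ _, p, (Finset.mem_filter.1 hp).2, rfl⟩
  · intro p hp p' hp' he
    by_contra hne
    have h1 := congrFun he p
    rw [Function.update_self, Function.update_of_ne hne, (Finset.mem_filter.1 hp).2] at h1
    exact hab h1
  · intro k hk
    rw [Finset.mem_filter, co_moved, nmat_eq_moved_iff l hab] at hk
    obtain ⟨-, p, hp, he⟩ := hk
    exact ⟨p, Finset.mem_filter.2 ⟨Finset.mem_univ _, hp⟩, he⟩

theorem sum_moved_gen (l : WComp n r) {a b : Fin n} (hab : a ≠ b) :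
    permEquiv ℂ 0 (theta (∑ m : WComp n r, if h : 0 < m.1 b then eA (moved m a b h) else 0)
      (gen ℂ 0 l)) = ∑ p, if iword l p = b then ξ ℂ (Function.update (iword l) p a) else 0 := by
  have h1 : ∀ m : WComp n r, permEquiv ℂ 0 (theta (if h : 0 < m.1 b then eA (moved m a b h) else 0)
      (gen ℂ 0 l)) = if l = m then
        ∑ p, if iword l p = b then ξ ℂ (Function.update (iword l) p a) else 0 else 0 := by
    intro m
    by_cases h : 0 < m.1 b
    · rw [dif_pos h, theta_eA, permEquiv_std_gen, co_moved]
      split_ifs with hm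
      · subst hm
        exact orb_moved l hab h
      · rfl
    · rw [dif_neg h, map_zero, LinearMap.zero_apply, map_zero]
      -- For `m = l` with no letter `b` available, the sum over positions is empty as well, in
      -- agreement with the default value zero.
      split_ifs with hm
      · subst hm
        rw [← exists_iword_eq] at h
        push Not at h
        simp [h]
      · rfl
  rw [map_sum, LinearMap.sum_apply, map_sum, Finset.sum_congr rfl fun m _ => h1 m,
    Finset.sum_ite_eq]
  simp

theorem psiEnd_e (i : Adj n) : psiEnd n r (U0.e i) = theta (eS i) := by
  refine schur_ext fun l => (permEquiv ℂ 0).injective ?_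
  rw [permEquiv_psiEnd, permEquiv_gen, eS, sum_moved_gen l i.lo_lt_hi.ne, rhoT_e]
  refine Finset.sum_congr rfl fun p _ => if_congr ?_ rfl rfl
  -- In an increasing word no letter `i` follows a letter `i+1`, so the proviso in the action of
  -- `e_i` is vacuous.
  refine and_iff_left_of_imp fun hp p' hp' he => ?_
  have := iword_monotone l hp'.le
  rw [hp, he] at this
  exact absurd i.lo_lt_hi (not_lt.2 this)

theorem psiEnd_f (i : Adj n) : psiEnd n r (U0.f i) = theta (fS i) := by
  refine schur_ext fun l => (permEquiv ℂ 0).injective ?_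
  rw [permEquiv_psiEnd, permEquiv_gen, fS, sum_moved_gen l i.lo_lt_hi.ne', rhoT_f]
  refine Finset.sum_congr rfl fun p _ => if_congr ?_ rfl rfl
  -- Likewise no letter `i+1` precedes a letter `i`.
  refine and_iff_left_of_imp fun hp p' hp' he => ?_
  have := iword_monotone l hp'.le
  rw [hp, he] at this
  exact absurd i.lo_lt_hi (not_lt.2 this)

theorem permEquiv_kS_gen (m l : WComp n r) :
    permEquiv ℂ 0 (theta (kS m) (gen ℂ 0 l)) = if l = m then ξ ℂ (iword l) else 0 := by
  have hco : ∀ h, co (⟨Matrix.diagonal m.1, h⟩ : NMat n r) = m := fun h =>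
    Subtype.ext (funext fun j => by simp [co, Matrix.diagonal_apply])
  rw [kS, theta_eA, permEquiv_std_gen, hco]
  split_ifs with hlm
  · subst hlm
    have hk : ∀ k : Fin r → Fin n, wmat k (iword l) = Matrix.diagonal l.1 ↔ k = iword l := by
      intro k
      constructor
      · intro h
        funext p
        by_contra hne
        have h1 : 0 < wmat k (iword l) (k p) (iword l p) := Finset.card_pos.2 ⟨p, by simp⟩
        rw [h, Matrix.diagonal_apply_ne _ hne] at h1
        exact absurd h1 (lt_irrefl 0)
      · rintro rfl
        rw [wmat_self, wt_iword]
    rw [orb, hco]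
    have hf : (Finset.univ.filter fun k : Fin r → Fin n => nmat k (iword l) =
        ⟨Matrix.diagonal l.1, by simp [Matrix.diagonal_apply, l.2]⟩) = {iword l} := by
      ext k
      rw [Finset.mem_filter, Finset.mem_singleton, ← hk, ← Subtype.coe_inj]
      simp [nmat]
    rw [hf, Finset.sum_singleton]
  · rfl

theorem psiEnd_k (i : Fin n) : psiEnd n r (U0.k i) =
    theta (∑ m ∈ Finset.univ.filter (fun m : WComp n r => m.1 i = 0), kS m) := by
  refine schur_ext fun l => (permEquiv ℂ 0).injective ?_
  rw [permEquiv_psiEnd, permEquiv_gen, rhoT_k, map_sum, LinearMap.sum_apply, map_sum,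
    Finset.sum_congr rfl fun m _ => permEquiv_kS_gen m l, Finset.sum_ite_eq]
  -- The letter `i` is absent from the increasing word of weight `l` exactly when `l` vanishes at
  -- `i`.
  refine if_congr ?_ rfl rfl
  have := exists_iword_eq (l := l) (b := i)
  rw [Finset.mem_filter, ← not_iff_not]
  push Not
  rw [this]
  simp [Nat.pos_iff_ne_zero]

end Images

end ZeroSchur

end

open ZeroSchur Polynomial in
/-- `Θ` is the specialization isomorphism from the `0`-Schur algebra to the endomorphism algebra of
`⨁ x_l H` for the `0`-Hecke algebra `H`, `φ₀` is the isomorphism of this module with the tensor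
space, and `ψ` corresponds to the action of `U_0(gl_n)` on the tensor space. Each is determined by
its condition (the first three conditions below), since the elements `gen l` generate `⨁ x_l H`. -/
theorem mainTheorem9 (n r : ℕ) :
    (∀ A : NMat n r, IsStd ℤ[X] X A (std ℤ[X] X A)) ∧
    ∃ (φ₀ : PermMod ℂ 0 n r ≃ₗ[(Hecke ℂ 0 r)ᵐᵒᵖ] TSpace ℂ n r)
      (Θ : SchurZero n r ≃ₐ[ℂ] Schur ℂ 0 n r)
      (ψ : U0 n →ₐ[ℂ] SchurZero n r),
      (∀ l : WComp n r, φ₀ (gen ℂ 0 l) = ξ ℂ (iword l)) ∧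
      (∀ (s : SchurQ n r) (m : PermMod ℤ[X] X n r), Θ (1 ⊗ₜ s) (specM m) = specM (s m)) ∧
      (∀ (u : U0 n) (m : PermMod ℂ 0 n r), φ₀ (Θ (ψ u) m) = rhoT n r u (φ₀ m)) ∧
      (∀ i : Adj n, ψ (U0.e i) = eS i) ∧
      (∀ i : Adj n, ψ (U0.f i) = fS i) ∧
      (∀ i : Fin n, ψ (U0.k i) = ∑ μ ∈ Finset.univ.filter (fun μ : WComp n r => μ.1 i = 0), kS μ) := by
  refine ⟨isStd_std ℤ[X] X, permEquiv ℂ 0, theta,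
    (theta (n := n) (r := r)).symm.toAlgHom.comp (psiEnd n r), permEquiv_gen ℂ 0, theta_specM,
    fun u m => ?_, fun i => ?_, fun i => ?_, fun i => ?_⟩
  · have h : theta ((theta (n := n) (r := r)).symm (psiEnd n r u)) = psiEnd n r u :=
      theta.apply_symm_apply _
    refine Eq.trans ?_ (permEquiv_psiEnd u m)
    exact congrArg (fun s : Schur ℂ 0 n r => permEquiv ℂ 0 (s m)) h
  · exact (AlgEquiv.symm_apply_eq theta).2 (psiEnd_e i)
  · exact (AlgEquiv.symm_apply_eq theta).2 (psiEnd_f i)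
  · exact (AlgEquiv.symm_apply_eq theta).2 (psiEnd_k i)
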